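/- Let $k\ge 0$ and $n_1,\dots,n_k\ge 0$ be integers, $n=n_1+\cdots+n_k$, and let $P=[n_1]+[n_2]+\cdots+[n_k]$ be the disjoint union of $k$ chains on the label set $[n]=\{1,\dots,n\}$, labeled consecutively within chains: with $N_i=n_1+\cdots+n_{i-1}$, the elements of the $i$-th chain are $N_i+1\prec N_i+2\prec\cdots\prec N_i+n_i$, and elements of different chains are incomparable. Let $\mathcal L(P)=\{\pi\in S_n : i\prec j \text{ in } P \Rightarrow \pi^{-1}_i<\pi^{-1}_j\}$ be the set of linear extensions of $P$, written in one-line notation $\pi=\pi_1\cdots\pi_n$. For $1\le i<n$ let $\pi\tau_i$ be obtained from $\pi$ by exchanging $\pi_i$ and $\pi_{i+1}$ if these are incomparable in $P$, and $\pi\tau_i=\pi$ otherwise. For $1\le j\le n$ let $\partial_j=\tau_j\tau_{j+1}\cdots\tau_{n-1}$ be the extended promotion operator, acting on $\mathcal L(P)$ from the right ($\tau_j$ is applied first). Let $x_1,\dots,x_n$ be elements of a commutative ring (for instance indeterminates). The promotion graph has vertex set $\mathcal L(P)$ and, for every $\pi\in\mathcal L(P)$ and $j\in[n]$, an edge $\pi\to\pi\partial_j$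 of weight $x_{\pi_j}$. Let $M$ be its transition matrix: for $\pi'\ne\pi$ the entry $M_{\pi',\pi}$ is the sum of the weights of all edges $\pi\to\pi'$, and $M_{\pi,\pi}$ is minus the sum of the weights of all edges leaving $\pi$ that are not loops. A poset derangement of a poset labeled by $[m]$ is a linear extension $\pi$ with $\pi_i\ne i$ for all $i\in[m]$. For a lower set $S\subseteq[n]$ of $P$, regard $S$ as an induced subposet of $P$, relabeled by $1,\dots,|S|$ in increasing order of its labels (it is then again a union of consecutively labeled chains), and let $\mathfrak d_S$ be the number of its poset derangements. Put $x_S=\sum_{i\in S}x_i$. **Theorem.** As polynomials in $\lambda$, $$\det(M-\lambda\mathbf 1)=(-1)^{|\mathcal L(P)|}\,\lambda\prod_{\substack{\emptyset\subsetneq S\subseteq[n]\\ S\text{ lower set in }P}}(\lambda+x_S)^{\mathfrak d_S}.$$ That is, besides the eigenvalue $0$ coming from the factor $\lambda$, $M$ has the eigenvalue $-x_S$ with multiplicity $\mathfrak d_S$ for each nonempty lower set $S$ of $P$. -/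

import Mathlib

open Polynomial

namespace PosetPromotion

/- A poset on the label set `[n]` is a term `P : PartialOrder (Fin n)`; labels and positions are
counted from `0`.  The symbols `<` and `≤` on `Fin n` denote the usual order of integers, while
`P.lt` and `P.le` denote the order of the poset. -/

/-- The linear extensions of `P`: permutations `π` (in one-line notation, `π j` is the entry at
position `j`) such that `i ≺ j` in `P` implies `π⁻¹ i < π⁻¹ j` as integers. -/
abbrev LinearExtension {n : ℕ} (P : PartialOrder (Fin n)) : Type :=
  {π : Equiv.Perm (Fin n) // ∀ i j : Fin n, P.lt i j → π⁻¹ i < π⁻¹ j}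

noncomputable instance {n : ℕ} (P : PartialOrder (Fin n)) : Fintype (LinearExtension P) :=
  Fintype.ofFinite _

/-- Exchanging two adjacent entries that are incomparable in `P` preserves linear extensions. -/
theorem swap_mem {n : ℕ} (P : PartialOrder (Fin n)) (π : LinearExtension P) (i : ℕ)
    (hi : i + 1 < n)
    (h : ¬ P.le (π.1 ⟨i, Nat.lt_of_succ_lt hi⟩) (π.1 ⟨i + 1, hi⟩)) (a b : Fin n)
    (hab : P.lt a b) :
    (π.1 * Equiv.swap (⟨i, Nat.lt_of_succ_lt hi⟩ : Fin n) ⟨i + 1, hi⟩)⁻¹ a <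
      (π.1 * Equiv.swap (⟨i, Nat.lt_of_succ_lt hi⟩ : Fin n) ⟨i + 1, hi⟩)⁻¹ b := by
  have h1 := π.2 a b hab
  have h2 : ¬ (π.1⁻¹ a = ⟨i, Nat.lt_of_succ_lt hi⟩ ∧ π.1⁻¹ b = ⟨i + 1, hi⟩) := by
    rintro ⟨ha, hb⟩
    rw [← ha, ← hb] at h
    exact h (by simpa using (@le_of_lt _ P.toPreorder _ _ hab))
  simp only [mul_inv_rev, Equiv.swap_inv, Equiv.Perm.mul_apply]
  generalize π.1⁻¹ a = u at h1 h2
  generalize π.1⁻¹ b = v at h1 h2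
  have hp : (⟨i, Nat.lt_of_succ_lt hi⟩ : Fin n).val = i := rfl
  have hq : (⟨i + 1, hi⟩ : Fin n).val = i + 1 := rfl
  generalize (⟨i, Nat.lt_of_succ_lt hi⟩ : Fin n) = p at hp h2 ⊢
  generalize (⟨i + 1, hi⟩ : Fin n) = q at hq h2 ⊢
  simp only [Equiv.swap_apply_def, Fin.ext_iff, Fin.lt_def] at h1 h2 ⊢
  split_ifs <;> omega

open scoped Classical in
/-- The operator `τ_i`: it exchanges the entries of `π` at the positions `i` and `i + 1` if they
are incomparable in `P`, and fixes `π` otherwise. -/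
noncomputable def tau {n : ℕ} (P : PartialOrder (Fin n)) (i : ℕ) (π : LinearExtension P) :
    LinearExtension P :=
  if h : ∃ hi : i + 1 < n,
      ¬ P.le (π.1 ⟨i, Nat.lt_of_succ_lt hi⟩) (π.1 ⟨i + 1, hi⟩) ∧
      ¬ P.le (π.1 ⟨i + 1, hi⟩) (π.1 ⟨i, Nat.lt_of_succ_lt hi⟩) then
    ⟨π.1 * Equiv.swap ⟨i, Nat.lt_of_succ_lt h.1⟩ ⟨i + 1, h.1⟩,
      swap_mem P π i h.1 h.2.1⟩
  else π

/-- The extended promotion operator `∂_j = τ_j τ_{j+1} ⋯`, acting on the right: `τ_j` is applied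
first, then `τ_{j+1}`, and so on up to the exchange of the last two positions `n - 2`, `n - 1`. -/
noncomputable def promotion {n : ℕ} (P : PartialOrder (Fin n)) (j : Fin n)
    (π : LinearExtension P) : LinearExtension P :=
  (List.range' j.val (n - 1 - j.val)).foldl (fun σ i => tau P i σ) π

open scoped Classical in
/-- The transition matrix of the promotion graph of `P`, in which there is, for every linear
extension `π` and every `j`, an edge `π → π ∂_j` of weight `x_{π_j}`.  For `π' ≠ π` the entry
`(π', π)` is the sum of the weights of all edges `π → π'`; the entry `(π, π)` is minus the sum of
the weights of all edges that leave `π` and are not loops. -/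
noncomputable def promotionMatrix {n : ℕ} (P : PartialOrder (Fin n)) {R : Type*} [CommRing R]
    (x : Fin n → R) : Matrix (LinearExtension P) (LinearExtension P) R :=
  Matrix.of fun π' π =>
    if π' = π then
      - ∑ j ∈ Finset.univ.filter (fun j : Fin n => promotion P j π ≠ π), x (π.1 j)
    else
      ∑ j ∈ Finset.univ.filter (fun j : Fin n => promotion P j π = π'), x (π.1 j)

/-- The number of poset derangements of `P`, i.e. linear extensions without fixed points. -/
noncomputable def numDerangements {n : ℕ} (P : PartialOrder (Fin n)) : ℕ :=
  Nat.card {π : LinearExtension P // ∀ i : Fin n, π.1 i ≠ i}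

/-- The subposet of `P` induced on `S`, its elements relabeled by `[|S|]` in increasing order of
their labels. -/
@[reducible] def restrict {n : ℕ} (P : PartialOrder (Fin n)) (S : Finset (Fin n)) :
    PartialOrder (Fin S.card) :=
  @PartialOrder.lift (Fin S.card) (Fin n) P (S.orderEmbOfFin rfl) (S.orderEmbOfFin rfl).injective

open scoped Classical in
/-- The nonempty lower sets of `P`. -/
noncomputable def nonemptyLowerSets {n : ℕ} (P : PartialOrder (Fin n)) :
    Finset (Finset (Fin n)) :=
  Finset.univ.filter fun S => S.Nonempty ∧ ∀ i ∈ S, ∀ j : Fin n, P.le j i → j ∈ S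

/-- The disjoint union `[m_1] + ⋯ + [m_k]` of chains, labeled consecutively within the chains:
the `k` chains receive successive blocks of labels, increasing along each chain.  The order on
the sigma type `Σ i, Fin (m i)` is that of the disjoint union (elements of different summands
are incomparable). -/
@[reducible] def chains {k : ℕ} (m : Fin k → ℕ) : PartialOrder (Fin (∑ i, m i)) :=
  PartialOrder.lift (finSigmaFinEquiv (n := m)).symm finSigmaFinEquiv.symm.injective

end PosetPromotion

namespace PosetPromotion

/-! Recording the chain of each entry turns a linear extension into a word with prescribed letter
counts. An edge of weight `x i` then moves one fixed occurrence of one letter to the end. Hence `M +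
(∑ i, x i) • 1` is a weighted sum of matrices of self-maps, and the theorem says that its
eigenvalues are the sums of `x` over complements of lower sets.

The spectrum is read off from traces of powers, so it suffices to count fixed points of every
composition `w` of moves. Let `s c` be the least rank in chain `c` touched by `w`, or the whole
length of the chain if none is. The first `s c` occurrences of each `c` keep their relative order,
and iterating `w` pushes everything else into a tail that no longer depends on the starting word. So
the fixed points correspond to the words of content `s` (`card_fixed_moveToEnd`).

Deleting the fixed entries of a word leaves a derangement, and they can be reinserted uniquely. Thus
the words of content `s` are counted by the derangements of all contents `t ≤ s`
(`card_word_eq_sum`), that is, by the sum of `𝔡_S` over lower sets `S` avoiding `w`. This equals the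
trace of `w` under a sum of one-dimensional characters, and `charpoly_weightedMapMatrix` turns it
into the factorization. -/

/-! ### Power sums, traces of powers and the characteristic polynomial. -/

theorem Multiset.eq_of_sum_pow_eq {K : Type*} [Field K] [CharZero K] {s t : Multiset K}
    (h : ∀ r : ℕ, (s.map (· ^ r)).sum = (t.map (· ^ r)).sum) : s = t := by
  classical
  have hp : ∀ p : K[X], (s.map fun a => p.eval a).sum = (t.map fun a => p.eval a).sum := by
    intro p
    induction p using Polynomial.induction_on' with
    | add p q hp hq => simp [Multiset.sum_map_add, hp, hq]
    | monomial n a => simp [Multiset.sum_map_mul_left, h]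
  ext a
  let T : Finset K := (s + t).toFinset.erase a
  -- `q` vanishes on all of `s + t` except at `a`, so summing its values over either multiset
  -- isolates the multiplicity of `a`.
  let q : K[X] := ∏ b ∈ T, (X - C b)
  have hqa : q.eval a ≠ 0 := by
    simp only [q, eval_prod, Finset.prod_ne_zero_iff, eval_sub, eval_X, eval_C]
    intro b hb
    exact sub_ne_zero.2 (Finset.ne_of_mem_erase hb).symm
  have key : ∀ u : Multiset K, (∀ b ∈ u, b ∈ s + t) →
      (u.map fun b => q.eval b).sum = u.count a * q.eval a := by
    intro u
    induction u using Multiset.induction_on with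
    | empty => simp
    | cons b u ih =>
      intro hu
      have ih' := ih fun c hc => hu c (Multiset.mem_cons_of_mem hc)
      rw [Multiset.map_cons, Multiset.sum_cons, ih']
      by_cases hab : b = a
      · subst hab
        simp; ring
      · have : q.eval b = 0 := by
          simp only [q, eval_prod]
          apply Finset.prod_eq_zero (i := b)
          · exact Finset.mem_erase.2 ⟨hab, Multiset.mem_toFinset.2 (hu b (by simp))⟩
          · simp
        rw [this, Multiset.count_cons_of_ne (Ne.symm hab)]; simp
  have h1 := hp q
  rw [key s fun b hb => Multiset.mem_add.2 (Or.inl hb),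
    key t fun b hb => Multiset.mem_add.2 (Or.inr hb)] at h1
  exact_mod_cast mul_right_cancel₀ hqa h1

/-- Both sides are multiplicative in `q`, which splits; for a linear factor the claim is the value
of the characteristic polynomial, up to sign. -/
theorem Matrix.det_aeval_eq_prod_roots {K n : Type*} [Field K] [IsAlgClosed K] [Fintype n]
    [DecidableEq n] (A : Matrix n n K) (q : K[X]) :
    (aeval A q).det = (A.charpoly.roots.map fun a => q.eval a).prod := by
  have hcard : A.charpoly.roots.card = Fintype.card n := by
    rw [← (IsAlgClosed.splits A.charpoly).natDegree_eq_card_roots, A.charpoly_natDegree_eq_dim]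
  have hlin : ∀ a : K, (A - algebraMap K _ a).det = (A.charpoly.roots.map fun b => b - a).prod := by
    intro a
    have h1 : A.charpoly.eval a = (A.charpoly.roots.map fun b => a - b).prod := by
      conv_lhs => rw [(IsAlgClosed.splits A.charpoly).eq_prod_roots_of_monic A.charpoly_monic]
      simp [eval_multiset_prod, Multiset.map_map]
    rw [Matrix.eval_charpoly] at h1
    have h2 : A - algebraMap K _ a = -(Matrix.scalar n a - A) := by
      simp [Matrix.algebraMap_eq_diagonal, Matrix.scalar_apply]
    rw [h2, Matrix.det_neg, h1, ← hcard]
    rw [← Multiset.card_map (fun b => a - b) , ← Multiset.prod_map_neg, Multiset.map_map]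
    simp
  rw [(IsAlgClosed.splits q).eq_prod_roots]
  generalize q.roots = s
  generalize q.leadingCoeff = c
  induction s using Multiset.induction_on with
  | empty =>
    simp [hcard, Matrix.algebraMap_eq_diagonal]
  | cons a s ih =>
    rw [Multiset.map_cons, Multiset.prod_cons, mul_left_comm, map_mul, Matrix.det_mul, ih]
    rw [map_sub, aeval_X, aeval_C, hlin, ← Multiset.prod_map_mul]
    simp

theorem Matrix.trace_pow_eq_sum_roots {K n : Type*} [Field K] [IsAlgClosed K] [Fintype n]
    [DecidableEq n] (A : Matrix n n K) (r : ℕ) :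
    (A ^ r).trace = (A.charpoly.roots.map (· ^ r)).sum := by
  have hcard : A.charpoly.roots.card = Fintype.card n := by
    rw [← (IsAlgClosed.splits A.charpoly).natDegree_eq_card_roots, A.charpoly_natDegree_eq_dim]
  have h : (A ^ r).charpoly = (A.charpoly.roots.map fun a => X - C (a ^ r)).prod := by
    apply Polynomial.funext
    intro y
    -- With `q = y - X ^ r` the determinant is the characteristic polynomial of `A ^ r` at `y`.
    have h1 := Matrix.det_aeval_eq_prod_roots A (C y - X ^ r)
    rw [Matrix.eval_charpoly]
    simp only [map_sub, aeval_C, map_pow, aeval_X, eval_sub, eval_C, eval_pow, eval_X] at h1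
    rw [eval_multiset_prod, Multiset.map_map]
    rw [Multiset.map_congr rfl fun a _ => (by simp :
      (eval y ∘ fun a => X - C (a ^ r)) a = y - a ^ r), ← h1]
    rfl
  rw [Matrix.trace_eq_sum_roots_charpoly, h]
  have : (A.charpoly.roots.map fun a => X - C (a ^ r)) =
      (A.charpoly.roots.map (· ^ r)).map fun a => X - C a := by simp
  rw [this, roots_multiset_prod_X_sub_C]

theorem Matrix.charpoly_eq_prod_of_trace_pow {K n : Type*} [Field K] [CharZero K] [Fintype n]
    [DecidableEq n] (A : Matrix n n K) (s : Multiset K)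
    (h : ∀ r : ℕ, (A ^ r).trace = (s.map (· ^ r)).sum) :
    A.charpoly = (s.map fun a => X - C a).prod := by
  let φ := algebraMap K (AlgebraicClosure K)
  apply Polynomial.map_injective φ φ.injective
  have h1 : (A.map φ).charpoly.roots = s.map φ := by
    apply Multiset.eq_of_sum_pow_eq
    intro r
    rw [← Matrix.trace_pow_eq_sum_roots]
    have : (A.map φ) ^ r = (A ^ r).map φ := by
      rw [← RingHom.mapMatrix_apply, ← RingHom.mapMatrix_apply, map_pow]
    rw [this]
    have h2 := congrArg φ (h r)
    rw [map_multiset_sum, Multiset.map_map] at h2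
    rw [Multiset.map_map]
    convert h2 using 1
    · exact (AddMonoidHom.map_trace φ.toAddMonoidHom _).symm
    · simp
  rw [← Matrix.charpoly_map,
    (IsAlgClosed.splits (A.map φ).charpoly).eq_prod_roots_of_monic (Matrix.charpoly_monic _), h1,
    Polynomial.map_multiset_prod, Multiset.map_map, Multiset.map_map]
  simp

/-! ### Weighted sums of self-maps and characters of the free monoid. -/

/-- The transition matrix of the self-maps `f i`, weighted by `x i`. -/
def weightedMapMatrix {Ω I R : Type*} [DecidableEq Ω] [Fintype I] [CommRing R]
    (f : I → Ω → Ω) (x : I → R) : Matrix Ω Ω R :=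
  Matrix.of fun ω' ω => ∑ i with f i ω = ω', x i

theorem weightedMapMatrix_map {Ω I R R' : Type*} [DecidableEq Ω] [Fintype I] [CommRing R]
    [CommRing R'] (f : I → Ω → Ω) (φ : R →+* R') (x : I → R) :
    (weightedMapMatrix f x).map φ = weightedMapMatrix f fun i => φ (x i) := by
  ext
  simp [weightedMapMatrix]

/-- Words in `I` span the free monoid algebra. On each word the trace counts fixed points, so `h`
identifies the trace with a sum of characters `χ S`, which kill the letters in `S` and send the
others to `1`. Both functionals are then evaluated at `(∑ x i · i) ^ r`. -/
theorem trace_weightedMapMatrix_pow {Ω I R : Type*} [Fintype Ω] [DecidableEq Ω] [Fintype I]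
    [DecidableEq I] [CommRing R] (f : I → Ω → Ω) (𝒮 : Finset (Finset I)) (d : Finset I → ℕ)
    (h : ∀ w : List I, (Finset.univ.filter fun ω => w.foldr f ω = ω).card =
      ∑ S ∈ 𝒮 with ∀ i ∈ w, i ∉ S, d S) (x : I → R) (r : ℕ) :
    (weightedMapMatrix f x ^ r).trace = ∑ S ∈ 𝒮, d S • (∑ i ∈ Sᶜ, x i) ^ r := by
  let P : FreeMonoid I →* Matrix Ω Ω R :=
    FreeMonoid.lift fun i => Matrix.of fun ω' ω => if f i ω = ω' then 1 else 0
  let ρ := MonoidAlgebra.lift R (Matrix Ω Ω R) (FreeMonoid I) P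
  let χ : Finset I → (MonoidAlgebra R (FreeMonoid I) →ₐ[R] R) := fun S =>
    MonoidAlgebra.lift R R (FreeMonoid I) (FreeMonoid.lift fun i => if i ∈ S then 0 else 1)
  let T₁ : MonoidAlgebra R (FreeMonoid I) →ₗ[R] R :=
    (Matrix.traceLinearMap Ω R R).comp ρ.toLinearMap
  let T₂ : MonoidAlgebra R (FreeMonoid I) →ₗ[R] R := ∑ S ∈ 𝒮, d S • (χ S).toLinearMap
  have hP : ∀ (w : List I) (ω' ω : Ω),
      P (FreeMonoid.ofList w) ω' ω = if w.foldr f ω = ω' then 1 else 0 := by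
    intro w
    induction w with
    | nil => intro ω' ω; simp [Matrix.one_apply, eq_comm]
    | cons i w ih =>
      intro ω' ω
      rw [FreeMonoid.ofList_cons, map_mul, Matrix.mul_apply]
      simp only [ih, P, FreeMonoid.lift_eval_of, Matrix.of_apply, List.foldr_cons, mul_ite,
        mul_one, mul_zero, Finset.sum_ite_eq, Finset.mem_univ, if_true]
      congr
  have hχ : ∀ (S : Finset I) (w : List I),
      FreeMonoid.lift (fun i => if i ∈ S then (0 : R) else 1) (FreeMonoid.ofList w) =
        if ∀ i ∈ w, i ∉ S then 1 else 0 := by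
    intro S w
    induction w with
    | nil => simp
    | cons i w ih =>
      rw [FreeMonoid.ofList_cons, map_mul, ih]
      by_cases hi : i ∈ S <;> simp [hi]
  have hT : T₁ = T₂ := by
    refine LinearMap.toAddMonoidHom_injective (MonoidAlgebra.addMonoidHom_ext fun w c => ?_)
    change T₁ _ = T₂ _
    have h1 := congrArg (Nat.cast : ℕ → R) (h w.toList)
    have h2 : ∀ ω' ω, P w ω' ω = if w.toList.foldr f ω = ω' then 1 else 0 := fun ω' ω => by
      have := hP w.toList ω' ω
      rwa [FreeMonoid.ofList_toList] at this
    have h3 : ∀ S : Finset I, FreeMonoid.lift (fun i => if i ∈ S then (0 : R) else 1) w =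
        if ∀ i ∈ w.toList, i ∉ S then 1 else 0 := fun S => by
      have := hχ S w.toList
      rwa [FreeMonoid.ofList_toList] at this
    have e1 : T₁ (MonoidAlgebra.single w c) = c * (P w).trace := by
      simp [T₁, ρ, MonoidAlgebra.lift_single]
    have e2 : T₂ (MonoidAlgebra.single w c) =
        c * ∑ S ∈ 𝒮, d S * (if ∀ i ∈ w.toList, i ∉ S then (1 : R) else 0) := by
      simp only [T₂, χ, LinearMap.sum_apply, LinearMap.smul_apply, AlgHom.toLinearMap_apply,
        MonoidAlgebra.lift_single, h3, Finset.mul_sum]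
      refine Finset.sum_congr rfl fun S _ => ?_
      simp only [nsmul_eq_mul, smul_eq_mul]
      ring
    rw [e1, e2]
    congr 1
    simp only [Matrix.trace, Matrix.diag_apply, h2]
    rw [Finset.sum_boole, h1, Nat.cast_sum, Finset.sum_filter]
    exact Finset.sum_congr rfl fun S _ => by split_ifs <;> simp
  let a : MonoidAlgebra R (FreeMonoid I) := ∑ i, MonoidAlgebra.single (FreeMonoid.of i) (x i)
  have ha : ρ a = weightedMapMatrix f x := by
    ext ω' ω
    simp only [a, ρ, map_sum, MonoidAlgebra.lift_single, P, FreeMonoid.lift_eval_of,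
      weightedMapMatrix, Matrix.sum_apply, Matrix.smul_apply, Matrix.of_apply, Finset.sum_filter]
    simp
  have hc : ∀ S, χ S a = ∑ i ∈ Sᶜ, x i := by
    intro S
    simp only [a, χ, map_sum, MonoidAlgebra.lift_single, FreeMonoid.lift_eval_of]
    rw [← Finset.sum_subset (Finset.subset_univ Sᶜ)]
    · refine Finset.sum_congr rfl fun i hi => ?_
      simp [Finset.mem_compl.1 hi]
    · intro i _ hi
      have : i ∈ S := by simpa using hi
      simp [this]
  have := LinearMap.congr_fun hT (a ^ r)
  simp only [T₁, T₂, LinearMap.comp_apply, AlgHom.toLinearMap_apply, map_pow, ha,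
    LinearMap.sum_apply, LinearMap.smul_apply, hc] at this
  exact this

/-- The characteristic polynomial of a weighted sum of self-maps of a finite set, when every
composition of these maps has as many fixed points as predicted by a family of characters. -/
theorem charpoly_weightedMapMatrix {Ω I R : Type*} [Fintype Ω] [DecidableEq Ω] [Fintype I]
    [DecidableEq I] [CommRing R] (f : I → Ω → Ω) (𝒮 : Finset (Finset I)) (d : Finset I → ℕ)
    (h : ∀ w : List I, (Finset.univ.filter fun ω => w.foldr f ω = ω).card =
      ∑ S ∈ 𝒮 with ∀ i ∈ w, i ∉ S, d S) (x : I → R) :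
    (weightedMapMatrix f x).charpoly = ∏ S ∈ 𝒮, (X - C (∑ i ∈ Sᶜ, x i)) ^ d S := by
  -- Power sums determine roots only in characteristic zero. Generic weights over `ℤ` are treated
  -- first, inside their fraction field, and then specialized to `R`.
  let F := FractionRing (MvPolynomial I ℤ)
  let ι : MvPolynomial I ℤ →+* F := algebraMap _ _
  have hι : Function.Injective ι := IsFractionRing.injective (MvPolynomial I ℤ) F
  have : CharZero F := charZero_of_injective_algebraMap (R := MvPolynomial I ℤ) hι
  have hF : (weightedMapMatrix f fun i => ι (MvPolynomial.X i)).charpoly =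
      ∏ S ∈ 𝒮, (X - C (∑ i ∈ Sᶜ, ι (MvPolynomial.X i))) ^ d S := by
    rw [Matrix.charpoly_eq_prod_of_trace_pow _
      (∑ S ∈ 𝒮, d S • {∑ i ∈ Sᶜ, ι (MvPolynomial.X i)})]
    · rw [← Multiset.coe_mapAddMonoidHom, map_sum, Multiset.prod_sum]
      simp [Multiset.map_nsmul, Multiset.prod_nsmul]
    · intro r
      rw [trace_weightedMapMatrix_pow f 𝒮 d h, ← Multiset.coe_mapAddMonoidHom, map_sum,
        ← Multiset.coe_sumAddMonoidHom, map_sum]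
      simp [Multiset.map_nsmul, Multiset.sum_nsmul]
  have hZ : (weightedMapMatrix f fun i => (MvPolynomial.X i : MvPolynomial I ℤ)).charpoly =
        ∏ S ∈ 𝒮, (X - C (∑ i ∈ Sᶜ, MvPolynomial.X i)) ^ d S := by
    apply Polynomial.map_injective ι hι
    rw [← Matrix.charpoly_map, weightedMapMatrix_map, hF]
    simp [Polynomial.map_prod, Polynomial.map_sum]
  have hR := congrArg (Polynomial.map (MvPolynomial.eval₂Hom (Int.castRingHom R) x)) hZ
  rw [← Matrix.charpoly_map, weightedMapMatrix_map] at hR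
  simpa [Polynomial.map_prod, Polynomial.map_sum] using hR

/-! ### Words, moves to the end, and fixed points of compositions of moves. -/

section Words

variable {κ : Type*} [DecidableEq κ]

/-- The words with `n c` occurrences of every letter `c`. -/
abbrev Word (n : κ → ℕ) : Type _ := {l : List κ // ∀ c, l.count c = n c}

/-- Remove the occurrence number `t` (counted from `0`) of the letter `c`. -/
def removeNth (c : κ) : ℕ → List κ → List κ
  | _, [] => []
  | t, a :: l =>
    if a = c then (if t = 0 then l else a :: removeNth c (t - 1) l) else a :: removeNth c t l

/-- Move the occurrence number `p.2` of the letter `p.1` to the end. -/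
def moveToEnd (p : κ × ℕ) (l : List κ) : List κ := removeNth p.1 p.2 l ++ [p.1]

/-- The subword formed by the first `s c` occurrences of every letter `c`. -/
def takeOcc : (κ → ℕ) → List κ → List κ
  | _, [] => []
  | s, a :: l =>
    if s a = 0 then takeOcc s l else a :: takeOcc (fun b => s b - if a = b then 1 else 0) l

theorem count_cons_ite (a b : κ) (l : List κ) :
    (a :: l).count b = l.count b + if a = b then 1 else 0 := by
  simp [List.count_cons]

theorem removeNth_append (c : κ) (t : ℕ) (u v : List κ) :
    removeNth c t (u ++ v) = if t < u.count c then removeNth c t u ++ v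
      else u ++ removeNth c (t - u.count c) v := by
  induction u generalizing t with
  | nil => simp
  | cons a u ih =>
    rw [List.cons_append, removeNth, removeNth, count_cons_ite, ih, ih]
    by_cases ha : a = c
    · rcases t with _ | t
      · simp [ha]
      · simp only [ha, if_true]
        by_cases h : t < u.count c
        · simp [h]
        · simp [h]
    · simp only [ha, if_false, Nat.add_zero]
      split_ifs <;> simp

theorem count_removeNth (c b : κ) (t : ℕ) (l : List κ) (ht : t < l.count c) :
    (removeNth c t l).count b = l.count b - if c = b then 1 else 0 := by
  induction l generalizing t with
  | nil => simp at ht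
  | cons a l ih =>
    rw [removeNth]
    rw [count_cons_ite] at ht
    by_cases ha : a = c
    · subst ha
      rcases t with _ | t
      · simp [count_cons_ite]
      · have h : t < l.count a := by simpa using ht
        simp only [if_true, Nat.add_one_ne_zero, if_false, Nat.add_sub_cancel]
        rw [count_cons_ite, count_cons_ite, ih t h]
        by_cases hb : a = b
        · subst hb; simp; omega
        · simp [hb]
    · have h : t < l.count c := by simpa [ha] using ht
      simp only [ha, if_false]
      rw [count_cons_ite, count_cons_ite, ih t h]
      by_cases hb : c = b
      · subst hb; simp [ha]
      · simp [hb]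

theorem count_moveToEnd (p : κ × ℕ) (b : κ) (l : List κ) (hp : p.2 < l.count p.1) :
    (moveToEnd p l).count b = l.count b := by
  rw [moveToEnd, List.count_append, count_removeNth _ _ _ _ hp, count_cons_ite]
  by_cases hb : p.1 = b
  · subst hb; simp; omega
  · simp [hb]

/-- Occurrences are counted from `0`, so number `t ≥ s c` is not among the first `s c`. -/
theorem takeOcc_removeNth (s : κ → ℕ) (c : κ) (t : ℕ) (l : List κ) (h : s c ≤ t) :
    takeOcc s (removeNth c t l) = takeOcc s l := by
  induction l generalizing s t with
  | nil => rfl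
  | cons a l ih =>
    rw [removeNth]
    by_cases ha : a = c
    · subst ha
      by_cases ht : t = 0
      · have : s a = 0 := by omega
        simp [ht, takeOcc, this]
      · simp only [ht, if_true, if_false, takeOcc]
        split_ifs with hs
        · exact ih _ _ (by omega)
        · rw [ih _ _ (by simp; omega)]
    · simp only [ha, if_false, takeOcc]
      split_ifs with hs
      · exact ih _ _ h
      · rw [ih _ _ (by simp [ha, h])]

theorem takeOcc_append (s : κ → ℕ) (u v : List κ) (h : ∀ c, s c ≤ u.count c) :
    takeOcc s (u ++ v) = takeOcc s u := by
  induction u generalizing s with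
  | nil =>
    have hs : ∀ c, s c = 0 := by simpa using h
    induction v with
    | nil => rfl
    | cons a v ih => simpa [takeOcc, hs] using ih
  | cons a u ih =>
    simp only [List.cons_append, takeOcc]
    simp only [count_cons_ite] at h
    split_ifs with hs
    · apply ih
      intro c
      have := h c
      by_cases hc : a = c
      · subst hc; omega
      · simpa [hc] using this
    · rw [ih]
      intro c
      have := h c
      omega

theorem takeOcc_of_count_le (s : κ → ℕ) (u : List κ) (h : ∀ c, u.count c ≤ s c) :
    takeOcc s u = u := by
  induction u generalizing s with
  | nil => rfl
  | cons a u ih =>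
    simp only [count_cons_ite] at h
    have ha := h a
    rw [takeOcc, if_neg (by simp at ha; omega), ih]
    intro c
    have := h c
    omega

theorem count_foldr_moveToEnd (n : κ → ℕ) (w : List (κ × ℕ)) (hw : ∀ p ∈ w, p.2 < n p.1)
    (l : List κ) (hl : ∀ c, l.count c = n c) (c : κ) :
    (w.foldr moveToEnd l).count c = n c := by
  induction w generalizing c with
  | nil => exact hl c
  | cons p w ih =>
    have h := ih fun q hq => hw q (List.mem_cons_of_mem _ hq)
    rw [List.foldr_cons, count_moveToEnd _ _ _ (by rw [h]; exact hw p List.mem_cons_self), h]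

/-- After some moves, a word splits as a subword of the initial word, whose content does not depend
on the initial word, and a word that does not depend on the initial word. -/
theorem exists_split_foldr_moveToEnd (s : κ → ℕ) (w : List (κ × ℕ)) (hw : ∀ p ∈ w, s p.1 ≤ p.2)
    (m : κ → ℕ) (hm : s ≤ m) (V : List κ) :
    ∃ (V' : List κ) (m' : κ → ℕ), s ≤ m' ∧ m' ≤ m ∧
      (∀ p ∈ w, p.2 = s p.1 → s p.1 < m p.1 → m' p.1 < m p.1) ∧
      ∀ u : List κ, (∀ c, u.count c = m c) → ∃ u' : List κ, (∀ c, u'.count c = m' c) ∧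
        takeOcc s u' = takeOcc s u ∧ w.foldr moveToEnd (u ++ V) = u' ++ V' := by
  induction w with
  | nil => exact ⟨V, m, hm, le_rfl, by simp, fun u hu => ⟨u, hu, rfl, rfl⟩⟩
  | cons p w ih =>
    obtain ⟨V', m', h1, h2, h3, h4⟩ := ih fun q hq => hw q (List.mem_cons_of_mem _ hq)
    have hp : s p.1 ≤ p.2 := hw p List.mem_cons_self
    -- Whether the moved occurrence lies in the prefix depends only on the content `m'`, so the case
    -- distinction is uniform in `u`.
    by_cases hlt : p.2 < m' p.1
    · refine ⟨V' ++ [p.1], fun c => m' c - if p.1 = c then 1 else 0, ?_, ?_, ?_, ?_⟩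
      · intro c
        have : s c ≤ m' c := h1 c
        by_cases hc : p.1 = c
        · subst hc; simp; omega
        · simpa [hc] using this
      · intro c
        have : m' c ≤ m c := h2 c
        simp only
        omega
      · intro q hq hq1 hq2
        rcases List.mem_cons.1 hq with rfl | hq
        · have : m' q.1 ≤ m q.1 := h2 q.1
          simp only [if_true]
          omega
        · have := h3 q hq hq1 hq2
          simp only
          omega
      · intro u hu
        obtain ⟨u', hu1, hu2, hu3⟩ := h4 u hu
        refine ⟨removeNth p.1 p.2 u', ?_, ?_, ?_⟩
        · intro c
          rw [count_removeNth _ _ _ _ (by rw [hu1]; exact hlt), hu1]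
        · rw [takeOcc_removeNth _ _ _ _ hp, hu2]
        · rw [List.foldr_cons, hu3, moveToEnd, removeNth_append, if_pos (by rw [hu1]; exact hlt),
            List.append_assoc]
    · refine ⟨removeNth p.1 (p.2 - m' p.1) V' ++ [p.1], m', h1, h2, ?_, ?_⟩
      · intro q hq hq1 hq2
        rcases List.mem_cons.1 hq with rfl | hq
        -- Here `m' q.1 ≤ q.2 = s q.1 < m q.1`.
        · omega
        · exact h3 q hq hq1 hq2
      · intro u hu
        obtain ⟨u', hu1, hu2, hu3⟩ := h4 u hu
        refine ⟨u', hu1, hu2, ?_⟩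
        rw [List.foldr_cons, hu3, moveToEnd, removeNth_append, if_neg (by rw [hu1]; exact hlt), hu1,
          List.append_assoc]

/-- While the prefix has more than `s c` letters `c`, each pass through `w` expels at least one of
them, because `w` contains the move of occurrence number `s c`. -/
theorem exists_split_iterate_moveToEnd (n s : κ → ℕ) (hs : s ≤ n) (w : List (κ × ℕ))
    (hw : ∀ p ∈ w, s p.1 ≤ p.2) (hc : ∀ c, s c < n c → (c, s c) ∈ w) (N : ℕ) :
    ∃ (V : List κ) (m : κ → ℕ), s ≤ m ∧ m ≤ n ∧ (∀ c, s c < m c → m c + N ≤ n c) ∧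
      ∀ u : List κ, (∀ c, u.count c = n c) → ∃ u' : List κ, (∀ c, u'.count c = m c) ∧
        takeOcc s u' = takeOcc s u ∧ (fun l => w.foldr moveToEnd l)^[N] u = u' ++ V := by
  induction N with
  | zero =>
    exact ⟨[], n, hs, le_rfl, fun c _ => le_rfl, fun u hu => ⟨u, hu, rfl, by simp⟩⟩
  | succ N ih =>
    obtain ⟨V, m, h1, h2, h3, h4⟩ := ih
    obtain ⟨V', m', g1, g2, g3, g4⟩ := exists_split_foldr_moveToEnd s w hw m h1 V
    refine ⟨V', m', g1, g2.trans h2, ?_, ?_⟩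
    · intro c hcm
      have e1 : s c < m c := hcm.trans_le (g2 c)
      have e2 := h3 c e1
      have e3 := g3 (c, s c) (hc c (e1.trans_le (h2 c))) rfl e1
      simp only at e3
      omega
    · intro u hu
      obtain ⟨u', hu1, hu2, hu3⟩ := h4 u hu
      obtain ⟨v, hv1, hv2, hv3⟩ := g4 u' hu1
      exact ⟨v, hv1, hv2.trans hu2, by rw [Function.iterate_succ_apply', hu3, hv3]⟩

theorem nonempty_word [Fintype κ] (n : κ → ℕ) : Nonempty (Word n) := by
  refine ⟨⟨(∑ c, Multiset.replicate (n c) c).toList, fun c => ?_⟩⟩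
  rw [← Multiset.coe_count, Multiset.coe_toList, Multiset.count_sum']
  simp [Multiset.count_replicate]

/-- The fixed points of a composition of moves correspond to the words on the letters that are not
affected. -/
theorem card_fixed_moveToEnd [Fintype κ] (n s : κ → ℕ) (hs : s ≤ n) (w : List (κ × ℕ))
    (hw : ∀ p ∈ w, s p.1 ≤ p.2 ∧ p.2 < n p.1) (hc : ∀ c, s c < n c → (c, s c) ∈ w) :
    Nat.card {l : Word n // w.foldr moveToEnd l.1 = l.1} = Nat.card (Word s) := by
  set F : List κ → List κ := fun l => w.foldr moveToEnd l with hF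
  have hFn : ∀ l : List κ, (∀ c, l.count c = n c) → ∀ c, (F l).count c = n c :=
    fun l hl => count_foldr_moveToEnd n w (fun p hp => (hw p hp).2) l hl
  -- More passes than any `n c`, so no surplus letter can survive in the prefix.
  set N := ∑ c, n c + 1
  obtain ⟨V, m, h1, h2, h3, h4⟩ :=
    exists_split_iterate_moveToEnd n s hs w (fun p hp => (hw p hp).1) hc N
  have hms : m = s := by
    funext c
    refine le_antisymm (not_lt.1 fun hlt => ?_) (h1 c)
    have e1 := h3 c hlt
    have e2 : n c ≤ ∑ c, n c := Finset.single_le_sum (fun _ _ => Nat.zero_le _) (Finset.mem_univ c)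
    omega
  subst hms
  have key : ∀ l : List κ, (∀ c, l.count c = n c) → F^[N] l = takeOcc m l ++ V := by
    intro l hl
    obtain ⟨u, hu1, hu2, hu3⟩ := h4 l hl
    rw [hu3, ← hu2, takeOcc_of_count_le m u fun c => (hu1 c).le]
  have hcount : ∀ l : List κ, (∀ c, l.count c = n c) → ∀ c, (takeOcc m l).count c = m c := by
    intro l hl
    obtain ⟨u, hu1, hu2, hu3⟩ := h4 l hl
    rwa [← hu2, takeOcc_of_count_le m u fun c => (hu1 c).le]
  have hiter : ∀ (l : List κ), (∀ c, l.count c = n c) → ∀ M c, (F^[M] l).count c = n c := by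
    intro l hl M
    induction M with
    | zero => exact hl
    | succ M ih => rw [Function.iterate_succ_apply']; exact hFn _ ih
  have hV : ∀ c, V.count c = n c - m c := by
    obtain ⟨⟨l, hl⟩⟩ := nonempty_word n
    intro c
    have e := hiter l hl N c
    rw [key l hl, List.count_append, hcount l hl] at e
    omega
  have hFtake : ∀ l : List κ, (∀ c, l.count c = n c) → takeOcc m (F l) = takeOcc m l := by
    intro l hl
    obtain ⟨V', m', g1, _, _, g4⟩ :=
      exists_split_foldr_moveToEnd m w (fun p hp => (hw p hp).1) n hs []
    obtain ⟨u, hu1, hu2, hu3⟩ := g4 l hl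
    rw [List.append_nil] at hu3
    change takeOcc m (w.foldr moveToEnd l) = _
    rw [hu3, takeOcc_append _ _ _ fun c => by rw [hu1]; exact g1 c, hu2]
  refine Nat.card_congr
    { toFun := fun l => ⟨takeOcc m l.1.1, hcount _ l.1.2⟩
      invFun := fun u => ⟨⟨u.1 ++ V, fun c => ?_⟩, ?_⟩
      left_inv := ?_
      right_inv := ?_ }
  · rw [List.count_append, u.2, hV]
    have : m c ≤ n c := hs c
    omega
  · have hu : ∀ c, (u.1 ++ V).count c = n c := fun c => by
      rw [List.count_append, u.2, hV]
      have : m c ≤ n c := hs c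
      omega
    have hfix : F^[N] (u.1 ++ V) = u.1 ++ V := by
      rw [key _ hu, takeOcc_append _ _ _ fun c => (u.2 c).ge,
        takeOcc_of_count_le _ _ fun c => (u.2 c).le]
    change F (u.1 ++ V) = u.1 ++ V
    -- `F` commutes with `F^[N]` and preserves the first `m c` occurrences, while `F^[N]` depends on
    -- those occurrences only. So `F` itself fixes what `F^[N]` fixes.
    have e : F (F^[N] (u.1 ++ V)) = F^[N] (F (u.1 ++ V)) := by
      rw [← Function.iterate_succ_apply' F N, Function.iterate_succ_apply]
    rw [hfix] at e
    rw [e, key _ (hFn _ hu), hFtake _ hu, ← key _ hu, hfix]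
  · rintro ⟨⟨l, hl⟩, hfix⟩
    simp only [Subtype.mk.injEq]
    rw [← key l hl]
    exact Function.iterate_fixed hfix N
  · rintro ⟨u, hu⟩
    simp only [Subtype.mk.injEq]
    rw [takeOcc_append _ _ _ fun c => (hu c).ge, takeOcc_of_count_le _ _ fun c => (hu c).le]

/-! ### Occurrences at a prescribed gap and insertion there. -/

/-- The number of occurrences of `c` that are preceded by exactly `g` other letters. -/
def gapCount (c : κ) : ℕ → List κ → ℕ
  | _, [] => 0
  | g, a :: l =>
    if a = c then gapCount c g l + (if g = 0 then 1 else 0)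
    else if g = 0 then 0 else gapCount c (g - 1) l

/-- Insert the letter `c` after `g` other letters. -/
def insertGap (c : κ) : ℕ → List κ → List κ
  | _, [] => [c]
  | g, a :: l =>
    if g = 0 then c :: a :: l
    else if a = c then a :: insertGap c g l else a :: insertGap c (g - 1) l

theorem insertGap_zero (c : κ) (l : List κ) : insertGap c 0 l = c :: l := by
  cases l <;> rfl

theorem insertGap_ne_nil (c : κ) (g : ℕ) (l : List κ) : insertGap c g l ≠ [] := by
  cases l <;> simp only [insertGap] <;> (try split_ifs) <;> simp

theorem insertGap_injective (c : κ) (g : ℕ) : Function.Injective (insertGap c g) := by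
  intro l l' h
  induction l generalizing g l' with
  | nil =>
    cases l' with
    | nil => rfl
    | cons b l' =>
      simp only [insertGap] at h
      split_ifs at h with h1 h2
      · simp at h
      · simp only [List.cons.injEq] at h
        exact absurd h.2.symm (insertGap_ne_nil _ _ _)
      · simp only [List.cons.injEq] at h
        exact absurd h.2.symm (insertGap_ne_nil _ _ _)
  | cons a l ih =>
    cases l' with
    | nil =>
      simp only [insertGap] at h
      split_ifs at h with h1 h2
      · simp at h
      · simp only [List.cons.injEq] at h
        exact absurd h.2 (insertGap_ne_nil _ _ _)
      · simp only [List.cons.injEq] at h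
        exact absurd h.2 (insertGap_ne_nil _ _ _)
    | cons b l' =>
      simp only [insertGap] at h
      split_ifs at h with h1 h2 h3 h3 <;> simp only [List.cons.injEq] at h ⊢
      · exact h.2
      · exact ⟨h.1, ih _ h.2⟩
      · exact absurd (h.1.symm.trans h2) h3
      · exact absurd (h.1.trans h3) h2
      · exact ⟨h.1, ih _ h.2⟩

theorem exists_insertGap (c : κ) (g : ℕ) (l : List κ) (h : gapCount c g l ≠ 0) :
    ∃ l', insertGap c g l' = l := by
  induction l generalizing g with
  | nil => simp [gapCount] at h
  | cons a l ih =>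
    by_cases hg : g = 0
    · subst hg
      by_cases ha : a = c
      · exact ⟨l, by rw [insertGap_zero, ha]⟩
      · simp [gapCount, ha] at h
    · by_cases ha : a = c
      · obtain ⟨l', hl'⟩ := ih g (by simpa [gapCount, ha, hg] using h)
        exact ⟨a :: l', by simp [insertGap, hg, ha, hl']⟩
      · obtain ⟨l', hl'⟩ := ih (g - 1) (by simpa [gapCount, ha, hg] using h)
        exact ⟨a :: l', by simp [insertGap, hg, ha, hl']⟩

theorem count_insertGap (c b : κ) (g : ℕ) (l : List κ) :
    (insertGap c g l).count b = l.count b + if c = b then 1 else 0 := by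
  induction l generalizing g with
  | nil => simp [insertGap, count_cons_ite]
  | cons a l ih =>
    simp only [insertGap, apply_ite (List.count b), count_cons_ite, ih]
    split_ifs <;> omega

theorem gapCount_le_count (c : κ) (g : ℕ) (l : List κ) : gapCount c g l ≤ l.count c := by
  induction l generalizing g with
  | nil => simp [gapCount]
  | cons a l ih =>
    simp only [gapCount, count_cons_ite]
    have h1 := ih g
    have h2 := ih (g - 1)
    split_ifs <;> omega

/-- The hypothesis provides at least `g` letters other than `c`; with fewer, `insertGap` would place
`c` at the end, at too small a gap. -/
theorem gapCount_insertGap_self (c : κ) (g : ℕ) (l : List κ) (h : g + l.count c ≤ l.length) :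
    gapCount c g (insertGap c g l) = gapCount c g l + 1 := by
  induction l generalizing g with
  | nil =>
    have : g = 0 := by simpa using h
    simp [insertGap, gapCount, this]
  | cons a l ih =>
    simp only [count_cons_ite, List.length_cons] at h
    by_cases hg : g = 0
    · subst hg
      simp [insertGap_zero, gapCount]
    · by_cases ha : a = c
      · simp only [ha, if_true] at h
        simp [insertGap, gapCount, ha, hg, ih g (by omega)]
      · simp only [ha, if_false] at h
        simp [insertGap, gapCount, ha, hg, ih (g - 1) (by omega)]

/-- The counted occurrences of `b` sit at positions below `gb + l.count b ≤ gc`, hence before the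
inserted letter if `l` is long enough, and also if the insertion falls at the end. -/
theorem gapCount_insertGap_of_lt (b c : κ) (hbc : b ≠ c) (gb gc : ℕ) (l : List κ)
    (h : gb + l.count b ≤ gc) : gapCount b gb (insertGap c gc l) = gapCount b gb l := by
  induction l generalizing gb gc with
  | nil => simp [insertGap, gapCount, hbc.symm]
  | cons a l ih =>
    simp only [count_cons_ite] at h
    by_cases hgc : gc = 0
    · subst hgc
      have hab : a ≠ b := by rintro rfl; simp at h
      have : gb = 0 := by omega
      simp [insertGap_zero, gapCount, hbc.symm, this, hab]
    · by_cases hab : a = b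
      · subst hab
        simp only [if_true] at h
        simp [insertGap, gapCount, hgc, hbc, ih gb (gc - 1) (by omega)]
      · simp only [hab, if_false] at h
        by_cases hac : a = c
        · simp only [insertGap, gapCount, hgc, hac, if_true, if_false, hbc.symm]
          by_cases hgb : gb = 0
          · simp [hgb]
          · simp [hgb, ih (gb - 1) gc (by omega)]
        · simp only [insertGap, gapCount, hgc, hac, if_false, hab]
          by_cases hgb : gb = 0
          · simp [hgb]
          · simp [hgb, ih (gb - 1) (gc - 1) (by omega)]

/-- A letter preceded by `gb` letters other than itself has at least `gc` letters other than `c`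
before it, so the insertion happens earlier and raises its gap by one. -/
theorem gapCount_insertGap_of_gt (b c : κ) (hbc : b ≠ c) (gb gc : ℕ) (l : List κ)
    (h : gc + l.count c ≤ gb) : gapCount b (gb + 1) (insertGap c gc l) = gapCount b gb l := by
  induction l generalizing gb gc with
  | nil => simp [insertGap, gapCount, hbc.symm]
  | cons a l ih =>
    simp only [count_cons_ite] at h
    by_cases hgc : gc = 0
    · subst hgc
      rw [insertGap_zero]
      conv_lhs => rw [gapCount]
      simp [hbc.symm]
    · obtain ⟨gb, rfl⟩ : ∃ g, gb = g + 1 := ⟨gb - 1, by omega⟩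
      by_cases hac : a = c
      · subst hac
        simp only [if_true] at h
        simp [insertGap, gapCount, hgc, hbc.symm, ih gb gc (by omega)]
      · simp only [hac, if_false] at h
        by_cases hab : a = b
        · subst hab
          simp [insertGap, gapCount, hgc, hbc, ih (gb + 1) (gc - 1) (by omega)]
        · simp [insertGap, gapCount, hgc, hac, hab, ih gb (gc - 1) (by omega)]

theorem length_eq_sum_count [Fintype κ] (l : List κ) : l.length = ∑ c, l.count c := by
  simpa using (Multiset.sum_count_eq_card (s := Finset.univ) (m := (l : Multiset κ))
    fun a _ => Finset.mem_univ a).symm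

instance [Fintype κ] (n : κ → ℕ) : Finite (Word n) := by
  have h : {l : List κ | l.length = ∑ c, n c}.Finite := List.finite_length_eq κ _
  refine (h.subset ?_).to_subtype (s := {l : List κ | ∀ c, l.count c = n c})
  intro l hl
  simp only [Set.mem_ofPred_eq] at hl ⊢
  rw [length_eq_sum_count]
  exact Finset.sum_congr rfl fun c _ => hl c

end Words

/-! ### Counting words by their fixed occurrences. -/

section Derangements

variable {κ : Type*} [LinearOrder κ] [Fintype κ]

/-- The number of letters smaller than `c`. -/
def offset (s : κ → ℕ) (c : κ) : ℕ := ∑ b with b < c, s b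

/-- The number of words of content `s` with `f c` fixed occurrences of each letter `c`. -/
noncomputable def numWordsFixing (s f : κ → ℕ) : ℕ :=
  Nat.card {l : Word s // ∀ c, gapCount c (offset s c) l.1 = f c}

theorem offset_add_le_offset (s : κ → ℕ) {b c : κ} (h : b < c) :
    offset s b + s b ≤ offset s c := by
  rw [offset, offset, add_comm, ← Finset.sum_insert (f := s) (a := b) (by simp)]
  apply Finset.sum_le_sum_of_subset
  intro a ha
  rcases Finset.mem_insert.1 ha with rfl | ha
  · simpa using h
  · simpa using ((Finset.mem_filter.1 ha).2.trans h)

theorem offset_add_le_sum (s : κ → ℕ) (c : κ) : offset s c + s c ≤ ∑ b, s b := by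
  rw [offset, add_comm, ← Finset.sum_insert (f := s) (a := c) (by simp)]
  exact Finset.sum_le_sum_of_subset (Finset.subset_univ _)

theorem offset_add_single (s : κ → ℕ) (b c : κ) :
    offset (s + Pi.single c 1) b = offset s b + if c < b then 1 else 0 := by
  simp only [offset, Pi.add_apply, Finset.sum_add_distrib]
  congr 1
  simp [Pi.single_apply]

/-- Inserting a `c` after `offset s c` other letters creates one fixed `c`. Smaller letters keep gap
and offset; for larger letters both grow by one, so no other fixed occurrence is gained or lost. -/
theorem numWordsFixing_add_single (s f : κ → ℕ) (c : κ) :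
    numWordsFixing (s + Pi.single c 1) (f + Pi.single c 1) = numWordsFixing s f := by
  have hgap : ∀ l : List κ, (∀ a, l.count a = s a) → ∀ b,
      gapCount b (offset (s + Pi.single c 1) b) (insertGap c (offset s c) l) =
        gapCount b (offset s b) l + (Pi.single c 1 : κ → ℕ) b := by
    intro l hl b
    rw [offset_add_single]
    rcases lt_trichotomy b c with h | rfl | h
    · rw [if_neg h.not_gt, Pi.single_eq_of_ne h.ne, add_zero, add_zero]
      exact gapCount_insertGap_of_lt b c h.ne _ _ l (by rw [hl]; exact offset_add_le_offset s h)
    · rw [if_neg (lt_irrefl _), Pi.single_eq_same, add_zero]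
      apply gapCount_insertGap_self
      rw [hl, length_eq_sum_count, Finset.sum_congr rfl fun a _ => hl a]
      exact offset_add_le_sum s b
    · rw [if_pos h, Pi.single_eq_of_ne h.ne', add_zero]
      exact gapCount_insertGap_of_gt b c h.ne' _ _ l (by rw [hl]; exact offset_add_le_offset s h)
  have hcount : ∀ l : List κ, (∀ a, l.count a = s a) ↔
      ∀ a, (insertGap c (offset s c) l).count a = (s + Pi.single c 1 : κ → ℕ) a := by
    intro l
    refine forall_congr' fun a => ?_
    rw [count_insertGap, Pi.add_apply, Pi.single_apply]
    simp only [eq_comm (a := a), Nat.add_right_cancel_iff]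
  symm
  refine Nat.card_congr (Equiv.ofBijective
    (fun l => ⟨⟨insertGap c (offset s c) l.1.1, (hcount _).1 l.1.2⟩, fun b => ?_⟩) ⟨?_, ?_⟩)
  · rw [hgap _ l.1.2, l.2, Pi.add_apply]
  · rintro ⟨⟨l, hl⟩, h⟩ ⟨⟨l', hl'⟩, h'⟩ e
    simp only [Subtype.mk.injEq] at e ⊢
    exact insertGap_injective _ _ e
  · rintro ⟨⟨l, hl⟩, h⟩
    have h0 : gapCount c (offset s c) l ≠ 0 := by
      have := h c
      simp only [offset_add_single, lt_irrefl, if_false, add_zero] at this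
      rw [this]
      simp
    obtain ⟨l', rfl⟩ := exists_insertGap _ _ _ h0
    have hl' := (hcount l').2 hl
    refine ⟨⟨⟨l', hl'⟩, fun b => ?_⟩, rfl⟩
    have := h b
    simp only at this
    rw [hgap _ hl', Pi.add_apply] at this
    exact Nat.add_right_cancel this

theorem numWordsFixing_add (s f g : κ → ℕ) :
    numWordsFixing (s + g) (f + g) = numWordsFixing s f := by
  induction hN : ∑ c, g c generalizing g with
  | zero =>
    have : g = 0 := by
      funext c
      exact (Finset.sum_eq_zero_iff.1 hN) c (Finset.mem_univ c)
    simp [this]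
  | succ N ih =>
    obtain ⟨c, -, hc⟩ : ∃ c ∈ Finset.univ, g c ≠ 0 :=
      Finset.exists_ne_zero_of_sum_ne_zero (by omega)
    obtain ⟨g', rfl⟩ : ∃ g', g = g' + Pi.single c 1 := by
      refine ⟨g - Pi.single c 1, (tsub_add_cancel_of_le ?_).symm⟩
      intro b
      by_cases hb : b = c
      · subst hb; simp; omega
      · simp [hb]
    rw [← add_assoc, ← add_assoc, numWordsFixing_add_single]
    apply ih
    simpa [Finset.sum_add_distrib] using hN

/-- Words are sorted by the vector `f` of their numbers of fixed occurrences; removing these leaves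
a derangement of content `n - f`. -/
theorem card_word_eq_sum (n : κ → ℕ) :
    Nat.card (Word n) = ∑ s ∈ Finset.Iic n, numWordsFixing s 0 := by
  classical
  let _ := Fintype.ofFinite (Word n)
  let F : Word n → κ → ℕ := fun l c => gapCount c (offset n c) l.1
  have h1 : Nat.card (Word n) = ∑ f ∈ Finset.Iic n, numWordsFixing n f := by
    rw [Nat.card_eq_fintype_card, ← Finset.card_univ,
      Finset.card_eq_sum_card_fiberwise (f := F) (t := Finset.Iic n)]
    · refine Finset.sum_congr rfl fun f _ => ?_
      rw [numWordsFixing, Nat.card_eq_fintype_card, Fintype.card_subtype]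
      simp only [F, funext_iff]
    · intro l _
      simp only [F, Finset.coe_Iic, Set.mem_Iic]
      intro c
      exact (gapCount_le_count _ _ _).trans (l.2 c).le
  rw [h1]
  refine Finset.sum_nbij' (fun f => n - f) (fun f => n - f) ?_ ?_ ?_ ?_ ?_
  · intro f _; simp
  · intro f _; simp
  · intro f hf; exact tsub_tsub_cancel_of_le (Finset.mem_Iic.1 hf)
  · intro f hf; exact tsub_tsub_cancel_of_le (Finset.mem_Iic.1 hf)
  · intro f hf
    have := numWordsFixing_add (n - f) 0 f
    rwa [tsub_add_cancel_of_le (Finset.mem_Iic.1 hf), zero_add] at this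

end Derangements

/-! ### Positions versus occurrence numbers in lists. -/

section ListLemmas

variable {κ : Type*} [DecidableEq κ]

theorem removeNth_count_take (l : List κ) (j : ℕ) (c : κ) (h : l[j]? = some c) :
    removeNth c ((l.take j).count c) l = l.eraseIdx j := by
  induction l generalizing j with
  | nil => simp at h
  | cons a l ih =>
    rcases j with _ | j
    · have ha : a = c := by simpa using h
      simp [removeNth, ha]
    · have h' : l[j]? = some c := by simpa using h
      rw [List.take_succ_cons, count_cons_ite, List.eraseIdx_cons_succ, removeNth, ← ih j h']
      by_cases ha : a = c <;> simp [ha]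

theorem gapCount_eq_zero_iff (c : κ) (g : ℕ) (l : List κ) :
    gapCount c g l = 0 ↔ ∀ j, l[j]? = some c → j ≠ g + (l.take j).count c := by
  induction l generalizing g with
  | nil => simp [gapCount]
  | cons a l ih =>
    have hsplit : ∀ p : ℕ → Prop, (∀ j, p j) ↔ p 0 ∧ ∀ j, p (j + 1) := fun p =>
      ⟨fun h => ⟨h 0, fun j => h _⟩, fun h j => by
        rcases j with _ | j
        exacts [h.1, h.2 j]⟩
    rw [hsplit]
    simp only [List.getElem?_cons_zero, List.getElem?_cons_succ, List.take_succ_cons, List.take_zero,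
      List.count_nil, count_cons_ite, gapCount, Option.some.injEq]
    by_cases ha : a = c
    · simp only [ha, if_true, forall_const]
      rw [Nat.add_eq_zero_iff, ih]
      constructor
      · rintro ⟨h1, h2⟩
        refine ⟨?_, fun j hj => ?_⟩
        · split_ifs at h2
          omega
        · have := h1 j hj
          omega
      · rintro ⟨h1, h2⟩
        refine ⟨fun j hj => ?_, if_neg (by omega)⟩
        have := h2 j hj
        omega
    · simp only [ha, if_false, Nat.add_zero, false_imp_iff, true_and]
      by_cases hg : g = 0
      · simp only [hg, if_true, true_iff]
        intro j _
        have : (l.take j).count c ≤ j := List.count_le_length.trans (by simp)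
        omega
      · rw [if_neg hg, ih]
        refine forall_congr' fun j => imp_congr_right fun _ => ?_
        omega

theorem count_take_ofFn {N : ℕ} (g : Fin N → κ) (j : ℕ) (c : κ) :
    ((List.ofFn g).take j).count c = (Finset.univ.filter fun i : Fin N => i < j ∧ g i = c).card := by
  induction j with
  | zero => simp
  | succ j ih =>
    rw [List.take_add_one, List.count_append, ih, List.getElem?_ofFn]
    by_cases hj : j < N
    · have hs : (Finset.univ.filter fun i : Fin N => (i : ℕ) < j + 1 ∧ g i = c) =
          (Finset.univ.filter fun i : Fin N => (i : ℕ) < j ∧ g i = c) ∪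
            (if g ⟨j, hj⟩ = c then {⟨j, hj⟩} else ∅) := by
        ext i
        simp only [Finset.mem_filter, Finset.mem_univ, true_and, Finset.mem_union]
        split_ifs with h
        · simp only [Finset.mem_singleton, Fin.ext_iff]
          constructor
          · rintro ⟨h1, h2⟩
            by_cases e : (i : ℕ) = j
            · exact Or.inr e
            · exact Or.inl ⟨by omega, h2⟩
          · rintro (⟨h1, h2⟩ | h1)
            · exact ⟨by omega, h2⟩
            · obtain rfl : i = ⟨j, hj⟩ := Fin.ext h1
              exact ⟨by simp, h⟩
        · simp only [Finset.notMem_empty, or_false]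
          refine ⟨fun ⟨h1, h2⟩ => ⟨?_, h2⟩, fun ⟨h1, h2⟩ => ⟨by omega, h2⟩⟩
          by_contra h3
          obtain rfl : i = ⟨j, hj⟩ := Fin.ext (by simp only; omega)
          exact h h2
      rw [hs, Finset.card_union_of_disjoint]
      · rw [dif_pos hj]
        split_ifs with h <;> simp [h]
      · split_ifs <;> simp
    · have hs : (Finset.univ.filter fun i : Fin N => (i : ℕ) < j + 1 ∧ g i = c) =
          (Finset.univ.filter fun i : Fin N => (i : ℕ) < j ∧ g i = c) := by
        ext i
        simp only [Finset.mem_filter, Finset.mem_univ, true_and]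
        have := i.2
        constructor <;> rintro ⟨h1, h2⟩ <;> exact ⟨by omega, h2⟩
      rw [hs]
      simp [hj]

end ListLemmas

/-! ### Linear extensions of a union of chains as words. -/

section ChainUnion

variable {κ : Type*} [LinearOrder κ] {N : ℕ}

/-- The poset is a disjoint union of chains, the fibers of `col`, which are labeled consecutively. -/
structure IsChainUnion (Q : PartialOrder (Fin N)) (col : Fin N → κ) : Prop where
  mono : ∀ i j : Fin N, i ≤ j → col i ≤ col j
  le_iff : ∀ i j, Q.le i j ↔ col i = col j ∧ i ≤ j

/-- The number of elements of a chain. -/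
def chainCard (col : Fin N → κ) (c : κ) : ℕ := (Finset.univ.filter fun i => col i = c).card

/-- The number of smaller elements of the chain of `i`. -/
def chainRank (col : Fin N → κ) (i : Fin N) : ℕ :=
  (Finset.univ.filter fun i' => i' < i ∧ col i' = col i).card

/-- The word of a linear extension. -/
def wordOf (col : Fin N → κ) (π : Equiv.Perm (Fin N)) : List κ := List.ofFn fun j => col (π j)

theorem chainRank_lt_chainCard (col : Fin N → κ) (i : Fin N) :
    chainRank col i < chainCard col (col i) := by
  apply Finset.card_lt_card
  rw [Finset.ssubset_iff_of_subset]
  · exact ⟨i, by simp⟩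
  · intro i'
    simp +contextual

variable {col : Fin N → κ}

/-- Labels smaller than `i` lie in an earlier chain, or lower in the chain of `i`. This is where
consecutive labeling enters. -/
theorem val_eq_offset_add_chainRank [Fintype κ] (hcol : ∀ i j : Fin N, i ≤ j → col i ≤ col j)
    (i : Fin N) :
    (i : ℕ) = offset (chainCard col) (col i) + chainRank col i := by
  have h1 : (Finset.univ.filter fun i' => col i' < col i).card =
      offset (chainCard col) (col i) := by
    rw [Finset.card_eq_sum_card_fiberwise (f := col) (t := Finset.univ.filter (· < col i))]
    · refine Finset.sum_congr rfl fun b hb => ?_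
      rw [chainCard, Finset.filter_filter]
      congr 1
      ext i'
      simp only [Finset.mem_filter, Finset.mem_univ, true_and, and_iff_right_iff_imp]
      rintro rfl
      simpa using hb
    · intro i' hi'
      simpa using hi'
  rw [← h1, chainRank, ← Finset.card_union_of_disjoint]
  · conv_lhs => rw [← Fin.card_Iio i]
    congr 1
    ext i'
    simp only [Finset.mem_Iio, Finset.mem_union, Finset.mem_filter, Finset.mem_univ, true_and]
    constructor
    · intro h
      rcases (hcol _ _ h.le).lt_or_eq with h2 | h2
      · exact Or.inl h2
      · exact Or.inr ⟨h, h2⟩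
    · rintro (h | h)
      · exact not_le.1 fun h' => (hcol _ _ h').not_gt h
      · exact h.1
  · rw [Finset.disjoint_filter]
    intro i' _ h1 h2
    exact h1.ne h2.2

theorem eq_of_col_eq_of_chainRank_eq [Fintype κ] (hcol : ∀ i j : Fin N, i ≤ j → col i ≤ col j)
    {i j : Fin N}
    (h1 : col i = col j) (h2 : chainRank col i = chainRank col j) : i = j := by
  apply Fin.ext
  rw [val_eq_offset_add_chainRank hcol i, val_eq_offset_add_chainRank hcol j, h1, h2]

/-- Each fiber of `g` is matched increasingly with the fiber of `col` of the same color. -/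
theorem exists_perm_of_card_fiber_eq (g col : Fin N → κ)
    (h : ∀ c, (Finset.univ.filter fun j => g j = c).card =
      (Finset.univ.filter fun i => col i = c).card) :
    ∃ π : Equiv.Perm (Fin N), (∀ j, col (π j) = g j) ∧
      ∀ j j', g j = g j' → (π j < π j' ↔ j < j') := by
  have hcard : ∀ c, Fintype.card {j // g j = c} = Fintype.card {i // col i = c} := by
    intro c
    rw [Fintype.card_subtype, Fintype.card_subtype, h]
  let iso : ∀ c, {j // g j = c} ≃o {i // col i = c} := fun c =>
    (Fintype.orderIsoFinOfCardEq _ (hcard c)).symm.trans (Fintype.orderIsoFinOfCardEq _ rfl)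
  let e : Fin N → Fin N := fun j => (iso (g j) ⟨j, rfl⟩).1
  have hcol : ∀ j, col (e j) = g j := fun j => (iso (g j) ⟨j, rfl⟩).2
  have he : ∀ j c (h : g j = c), e j = (iso c ⟨j, h⟩).1 := by
    rintro j _ rfl
    rfl
  have hlt : ∀ j j', g j = g j' → (e j < e j' ↔ j < j') := by
    intro j j' h
    rw [he j _ h, he j' _ rfl, Subtype.coe_lt_coe, (iso _).lt_iff_lt, Subtype.mk_lt_mk]
  have hinj : Function.Injective e := by
    intro j j' h
    have hg : g j = g j' := by rw [← hcol, ← hcol, h]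
    have h1 := hlt j j' hg
    have h2 := hlt j' j hg.symm
    rw [h] at h1 h2
    exact le_antisymm (not_lt.1 fun h' => lt_irrefl _ (h2.2 h'))
      (not_lt.1 fun h' => lt_irrefl _ (h1.2 h'))
  exact ⟨Equiv.ofBijective e (Finite.injective_iff_bijective.1 hinj), hcol, hlt⟩

variable {Q : PartialOrder (Fin N)}

theorem IsChainUnion.lt_iff (hQ : IsChainUnion Q col) (i j : Fin N) :
    Q.lt i j ↔ col i = col j ∧ i < j := by
  rw [Q.lt_iff_le_not_ge, hQ.le_iff, hQ.le_iff]
  constructor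
  · rintro ⟨⟨h1, h2⟩, h3⟩
    exact ⟨h1, Fin.not_le.1 fun h => h3 ⟨h1.symm, h⟩⟩
  · rintro ⟨h1, h2⟩
    exact ⟨⟨h1, Fin.le_of_lt h2⟩, fun h => absurd h.2 (Fin.not_le.2 h2)⟩

theorem IsChainUnion.inv_lt_inv_iff (hQ : IsChainUnion Q col) (π : LinearExtension Q) {i j : Fin N}
    (h : col i = col j) : π.1⁻¹ i < π.1⁻¹ j ↔ i < j := by
  refine ⟨fun h1 => ?_, fun h1 => π.2 i j ((hQ.lt_iff _ _).2 ⟨h, h1⟩)⟩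
  by_contra h2
  rcases Fin.lt_or_eq_of_le (Fin.not_lt.1 h2) with h2 | rfl
  · exact Fin.lt_asymm h1 (π.2 j i ((hQ.lt_iff _ _).2 ⟨h.symm, h2⟩))
  · exact Fin.lt_irrefl _ h1

theorem count_wordOf (π : Equiv.Perm (Fin N)) (c : κ) :
    (wordOf col π).count c = chainCard col c := by
  have h := count_take_ofFn (fun j => col (π j)) N c
  rw [List.take_of_length_le (by simp)] at h
  rw [wordOf, h, chainCard, ← Finset.card_map π.toEmbedding]
  congr 1
  ext i
  simp only [Finset.mem_map_equiv, Finset.mem_filter, Finset.mem_univ, true_and, Fin.is_lt]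
  simp

theorem IsChainUnion.count_take_wordOf (hQ : IsChainUnion Q col) (π : LinearExtension Q)
    (j : Fin N) : ((wordOf col π.1).take j).count (col (π.1 j)) = chainRank col (π.1 j) := by
  rw [wordOf, count_take_ofFn, chainRank, ← Finset.card_map π.1.toEmbedding]
  congr 1
  ext i
  simp only [Finset.mem_map_equiv, Finset.mem_filter, Finset.mem_univ, true_and, Fin.val_fin_lt,
    Equiv.apply_symm_apply]
  refine and_congr_left fun h => ?_
  have := hQ.inv_lt_inv_iff π h
  rwa [Equiv.Perm.inv_def, Equiv.symm_apply_apply] at this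

theorem wordOf_getElem? {κ : Type*} {N : ℕ} {col : Fin N → κ} (π : Equiv.Perm (Fin N)) (j : Fin N) :
    (wordOf col π)[(j : ℕ)]? = some (col (π j)) := by
  simp [wordOf]

/-- The word of a linear extension, with its content. -/
def toWord (col : Fin N → κ) (π : LinearExtension Q) : Word (chainCard col) :=
  ⟨wordOf col π.1, count_wordOf π.1⟩

theorem IsChainUnion.toWord_injective [Fintype κ] (hQ : IsChainUnion Q col) :
    Function.Injective (toWord col : LinearExtension Q → _) := by
  intro π π' h
  have hw : wordOf col π.1 = wordOf col π'.1 := congrArg Subtype.val h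
  apply Subtype.ext
  ext1 j
  have hc : col (π.1 j) = col (π'.1 j) := by
    have := wordOf_getElem? (col := col) π.1 j
    rw [hw, wordOf_getElem?] at this
    simpa using this.symm
  apply eq_of_col_eq_of_chainRank_eq hQ.mono hc
  rw [← hQ.count_take_wordOf, ← hQ.count_take_wordOf, hw, hc]

theorem IsChainUnion.toWord_surjective [Fintype κ] (hQ : IsChainUnion Q col) :
    Function.Surjective (toWord col : LinearExtension Q → _) := by
  rintro ⟨l, hl⟩
  have hlen : l.length = N := by
    rw [length_eq_sum_count, Finset.sum_congr rfl fun c _ => hl c]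
    unfold chainCard
    rw [← Finset.card_eq_sum_card_fiberwise (fun _ _ => Finset.mem_coe.2 (Finset.mem_univ _))]
    simp
  obtain ⟨g, rfl⟩ : ∃ g : Fin N → κ, List.ofFn g = l := by
    subst hlen
    exact ⟨l.get, List.ofFn_get l⟩
  obtain ⟨π, hcol, hlt⟩ := exists_perm_of_card_fiber_eq g col fun c => by
    have h := count_take_ofFn g N c
    rw [List.take_of_length_le (by simp), hl, chainCard] at h
    rw [h]
    simp
  refine ⟨⟨π, fun i i' h => ?_⟩, Subtype.ext ?_⟩
  · obtain ⟨h1, h2⟩ := (hQ.lt_iff _ _).1 h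
    rw [Equiv.Perm.inv_def, ← hlt, Equiv.apply_symm_apply, Equiv.apply_symm_apply]
    · exact h2
    · rw [← hcol, ← hcol, Equiv.apply_symm_apply, Equiv.apply_symm_apply, h1]
  · simp [toWord, wordOf, hcol]

/-- Linear extensions of a union of chains are words. -/
noncomputable def IsChainUnion.wordEquiv [Fintype κ] (hQ : IsChainUnion Q col) :
    LinearExtension Q ≃ Word (chainCard col) :=
  Equiv.ofBijective (toWord col) ⟨hQ.toWord_injective, hQ.toWord_surjective⟩

/-- The label at position `j` is the offset of its chain plus the number of earlier equal letters.
So it equals `j` exactly when the number of earlier different letters is that offset. -/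
theorem IsChainUnion.numDerangements_eq [Fintype κ] (hQ : IsChainUnion Q col) :
    numDerangements Q = numWordsFixing (chainCard col) 0 := by
  refine Nat.card_congr (Equiv.subtypeEquiv hQ.wordEquiv fun π => ?_)
  change _ ↔ ∀ c, gapCount c (offset (chainCard col) c) (wordOf col π.1) = 0
  simp only [gapCount_eq_zero_iff]
  have key : ∀ j, π.1 j = j ↔
      (j : ℕ) = offset (chainCard col) (col (π.1 j)) +
        ((wordOf col π.1).take j).count (col (π.1 j)) := by
    intro j
    rw [hQ.count_take_wordOf, ← val_eq_offset_add_chainRank hQ.mono, Fin.ext_iff, eq_comm]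
  constructor
  · intro h c j hj
    have hjN : j < N := by
      have := (List.getElem?_eq_some_iff.1 hj).1
      simpa [wordOf] using this
    have h1 := wordOf_getElem? (col := col) π.1 ⟨j, hjN⟩
    simp only [hj, Option.some.injEq] at h1
    have h2 := (key ⟨j, hjN⟩).not.1 (h _)
    rwa [← h1] at h2
  · intro h j
    rw [Ne, key]
    exact h _ j (wordOf_getElem? π.1 j)

/-- Comparable entries carry the same letter, so on words the operator always exchanges the two
positions, even when it fixes the linear extension. -/
theorem IsChainUnion.wordOf_tau (hQ : IsChainUnion Q col) (i : ℕ) (hi : i + 1 < N)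
    (π : LinearExtension Q) (p : ℕ) :
    (wordOf col (tau Q i π).1)[p]? =
      (wordOf col π.1)[if p = i then i + 1 else if p = i + 1 then i else p]? := by
  rw [tau]
  split_ifs with h h1 h2 h1 h2
  · simp [wordOf, h1, Nat.lt_of_succ_lt hi, hi]
  · simp [wordOf, h2, Nat.lt_of_succ_lt hi, hi]
  · simp only [wordOf, List.getElem?_ofFn]
    split_ifs with hp
    · rw [Equiv.Perm.mul_apply, Equiv.swap_apply_of_ne_of_ne] <;> simp [Fin.ext_iff, h1, h2]
    · rfl
  all_goals
    have hc : col (π.1 ⟨i, Nat.lt_of_succ_lt hi⟩) = col (π.1 ⟨i + 1, hi⟩) := by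
      by_contra hc
      exact h ⟨hi, fun h' => hc ((hQ.le_iff _ _).1 h').1,
        fun h' => hc ((hQ.le_iff _ _).1 h').1.symm⟩
  · simp [wordOf, h1, Nat.lt_of_succ_lt hi, hi, hc]
  · simp [wordOf, h2, Nat.lt_of_succ_lt hi, hi, hc]
  · rfl

/-- Successive exchanges carry the letter at `j` to `j + r` and shift those in between one place
left. -/
theorem IsChainUnion.wordOf_foldl_tau (hQ : IsChainUnion Q col) (j r : ℕ) (hr : j + r < N)
    (π : LinearExtension Q) (p : ℕ) :
    (wordOf col ((List.range' j r).foldl (fun σ i => tau Q i σ) π).1)[p]? =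
      (wordOf col π.1)[if p < j ∨ j + r < p then p else if p < j + r then p + 1 else j]? := by
  induction r generalizing p with
  | zero =>
    simp only [List.range'_zero, List.foldl_nil]
    congr 1
    split_ifs <;> omega
  | succ r ih =>
    rw [List.range'_1_concat, List.foldl_append, List.foldl_cons, List.foldl_nil,
      hQ.wordOf_tau _ (by omega), ih (by omega)]
    congr 1
    split_ifs <;> omega

theorem IsChainUnion.wordOf_promotion (hQ : IsChainUnion Q col) (π : LinearExtension Q)
    (j : Fin N) : wordOf col (promotion Q j π).1 =
      moveToEnd (col (π.1 j), chainRank col (π.1 j)) (wordOf col π.1) := by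
  rw [moveToEnd, ← hQ.count_take_wordOf, removeNth_count_take _ _ _ (wordOf_getElem? _ _)]
  have hj := j.2
  have hlen : (wordOf col π.1).length = N := by simp [wordOf]
  apply List.ext_getElem?
  intro p
  rw [promotion, hQ.wordOf_foldl_tau _ _ (by omega), List.getElem?_append,
    List.length_eraseIdx_of_lt (by rw [hlen]; exact hj), List.getElem?_eraseIdx, hlen]
  rcases lt_trichotomy p (N - 1) with hp | rfl | hp
  · rw [if_pos hp]
    by_cases h : p < j
    · simp [h]
    · rw [if_neg (by omega), if_pos (by omega), if_neg h]
  · rw [if_neg (by omega), if_neg (by omega), if_neg (by omega), wordOf_getElem?]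
    simp
  · rw [if_pos (by omega), if_neg (by omega), List.getElem?_eq_none (by omega),
      List.getElem?_eq_none (by simp; omega)]

end ChainUnion

/-! ### Lower sets as contents, and the fixed-point count. -/

section LowerSets

variable {κ : Type*} [LinearOrder κ] {N : ℕ} {col : Fin N → κ}

theorem exists_chainRank_eq [Fintype κ] (hcol : ∀ i j : Fin N, i ≤ j → col i ≤ col j) (c : κ)
    (t : ℕ) (ht : t < chainCard col c) : ∃ i, col i = c ∧ chainRank col i = t := by
  have h := Finset.surjOn_of_injOn_of_card_le (s := Finset.univ.filter fun i => col i = c)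
    (t := Finset.range (chainCard col c)) (chainRank col) ?_ ?_ (by simp [chainCard])
  · obtain ⟨i, hi, h⟩ := h (Finset.mem_coe.2 (Finset.mem_range.2 ht))
    exact ⟨i, by simpa using hi, h⟩
  · intro i hi
    have hi : col i = c := by simpa using hi
    simpa [← hi] using chainRank_lt_chainCard col i
  · intro i hi j hj h
    have hi : col i = c := by simpa using hi
    have hj : col j = c := by simpa using hj
    exact eq_of_col_eq_of_chainRank_eq hcol (hi.trans hj.symm) h

theorem card_chainRank_lt [Fintype κ] (hcol : ∀ i j : Fin N, i ≤ j → col i ≤ col j) (c : κ)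
    (t : ℕ) (ht : t ≤ chainCard col c) :
    (Finset.univ.filter fun i => chainRank col i < t ∧ col i = c).card = t := by
  conv_rhs => rw [← Finset.card_range t]
  refine Finset.card_nbij (chainRank col) ?_ ?_ ?_
  · intro i
    simp +contextual
  · intro i hi j hj h
    have hi : chainRank col i < t ∧ col i = c := by simpa using hi
    have hj : chainRank col j < t ∧ col j = c := by simpa using hj
    exact eq_of_col_eq_of_chainRank_eq hcol (hi.2.trans hj.2.symm) h
  · intro r hr
    have hr : r < t := by simpa using hr
    obtain ⟨i, h1, h2⟩ := exists_chainRank_eq hcol c r (hr.trans_le ht)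
    exact ⟨i, by simp [h1, h2, hr], h2⟩

/-- The number of elements of `S` in the chain `c`. -/
def colorCount (col : Fin N → κ) (S : Finset (Fin N)) (c : κ) : ℕ :=
  (S.filter fun i => col i = c).card

theorem chainRank_lt_chainRank {i j : Fin N} (h : i < j) (hc : col i = col j) :
    chainRank col i < chainRank col j := by
  apply Finset.card_lt_card
  rw [Finset.ssubset_iff_of_subset]
  · exact ⟨i, by simp [h, hc]⟩
  · intro i'
    simp only [Finset.mem_filter, Finset.mem_univ, true_and]
    exact fun h' => ⟨h'.1.trans h, h'.2.trans hc⟩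

theorem mem_iff_chainRank_lt_colorCount (S : Finset (Fin N))
    (hS : ∀ i ∈ S, ∀ j, col j = col i → j ≤ i → j ∈ S) (i : Fin N) :
    i ∈ S ↔ chainRank col i < colorCount col S (col i) := by
  constructor
  · intro hi
    apply Finset.card_lt_card
    rw [Finset.ssubset_iff_of_subset]
    · exact ⟨i, by simp [hi]⟩
    · intro j
      simp only [Finset.mem_filter, Finset.mem_univ, true_and]
      exact fun hj => ⟨hS i hi j hj.2 hj.1.le, hj.2⟩
  · intro h
    by_contra hi
    refine absurd h (not_lt.2 (Finset.card_le_card ?_))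
    intro j
    simp only [Finset.mem_filter, Finset.mem_univ, true_and]
    exact fun hj => ⟨not_le.1 fun hij => hi (hS j hj.1 i hj.2.symm hij), hj.2⟩

theorem orderEmbOfFin_le_iff (S : Finset (Fin N)) (i j : Fin S.card) :
    S.orderEmbOfFin rfl i ≤ S.orderEmbOfFin rfl j ↔ i ≤ j :=
  (S.orderEmbOfFin rfl).le_iff_le

variable {Q : PartialOrder (Fin N)}

theorem IsChainUnion.restrict (hQ : IsChainUnion Q col) (S : Finset (Fin N)) :
    IsChainUnion (restrict Q S) (fun t => col (S.orderEmbOfFin rfl t)) where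
  mono i j h := hQ.mono _ _ ((orderEmbOfFin_le_iff S i j).2 h)
  le_iff i j := by
    rw [← orderEmbOfFin_le_iff S]
    exact hQ.le_iff _ _

theorem chainCard_orderEmbOfFin (col : Fin N → κ) (S : Finset (Fin N)) :
    chainCard (fun t => col (S.orderEmbOfFin rfl t)) = colorCount col S := by
  funext c
  rw [chainCard, colorCount]
  conv_rhs => rw [← Finset.map_orderEmbOfFin_univ S rfl, Finset.filter_map, Finset.card_map]
  rfl

theorem IsChainUnion.numDerangements_restrict [Fintype κ] (hQ : IsChainUnion Q col)
    (S : Finset (Fin N)) : numDerangements (PosetPromotion.restrict Q S) =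
      numWordsFixing (colorCount col S) 0 := by
  rw [(hQ.restrict S).numDerangements_eq, chainCard_orderEmbOfFin]

open scoped Classical in
/-- The lower sets of a poset. -/
noncomputable def lowerSets (Q : PartialOrder (Fin N)) : Finset (Finset (Fin N)) :=
  Finset.univ.filter fun S => ∀ i ∈ S, ∀ j : Fin N, Q.le j i → j ∈ S

theorem mem_lowerSets (S : Finset (Fin N)) :
    S ∈ lowerSets Q ↔ ∀ i ∈ S, ∀ j : Fin N, Q.le j i → j ∈ S := by
  simp [lowerSets]

theorem IsChainUnion.mem_lowerSets_iff (hQ : IsChainUnion Q col) (S : Finset (Fin N)) :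
    S ∈ lowerSets Q ↔ ∀ i ∈ S, ∀ j, col j = col i → j ≤ i → j ∈ S := by
  simp only [mem_lowerSets, hQ.le_iff, and_imp]

/-- The contents of the lower sets that avoid `w`. -/
theorem IsChainUnion.sum_lowerSets [Fintype κ] (hQ : IsChainUnion Q col) (w : List (Fin N))
    (s : κ → ℕ) (hs : s ≤ chainCard col) (hw : ∀ i ∈ w, s (col i) ≤ chainRank col i)
    (hc : ∀ c, s c < chainCard col c → (c, s c) ∈ w.map fun i => (col i, chainRank col i))
    (d : (κ → ℕ) → ℕ) :
    ∑ S ∈ lowerSets Q with ∀ i ∈ w, i ∉ S, d (colorCount col S) = ∑ t ∈ Finset.Iic s, d t := by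
  -- A lower set is an initial segment of each chain, hence determined by its content. It avoids `w`
  -- exactly when the content is at most `s`.
  refine Finset.sum_nbij' (fun S => colorCount col S)
    (fun t => Finset.univ.filter fun i => chainRank col i < t (col i)) ?_ ?_ ?_ ?_ ?_
  · intro S hS
    obtain ⟨hS, hSw⟩ := Finset.mem_filter.1 hS
    rw [hQ.mem_lowerSets_iff] at hS
    rw [Finset.mem_Iic]
    intro c
    by_cases h : s c < chainCard col c
    · obtain ⟨i, hi, e⟩ := List.mem_map.1 (hc c h)
      simp only [Prod.mk.injEq] at e
      obtain ⟨rfl, e⟩ := e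
      rw [← e]
      exact not_lt.1 ((mem_iff_chainRank_lt_colorCount S hS i).not.1 (hSw i hi))
    · exact (Finset.card_le_card (Finset.filter_subset_filter _ (Finset.subset_univ S))).trans
        (not_lt.1 h)
  · intro t ht
    rw [Finset.mem_Iic] at ht
    rw [Finset.mem_filter, hQ.mem_lowerSets_iff]
    refine ⟨?_, fun i hi h => ?_⟩
    · intro i hi j hji hj
      simp only [Finset.mem_filter, Finset.mem_univ, true_and] at hi ⊢
      rcases Fin.lt_or_eq_of_le hj with hlt | rfl
      · rw [hji]
        exact (chainRank_lt_chainRank hlt hji).trans hi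
      · exact hi
    · have h1 : chainRank col i < t (col i) := by simpa using h
      exact absurd (h1.trans_le (ht _)) (not_lt.2 (hw i hi))
  · intro S hS
    obtain ⟨hS, hSw⟩ := Finset.mem_filter.1 hS
    rw [hQ.mem_lowerSets_iff] at hS
    ext i
    rw [mem_iff_chainRank_lt_colorCount S hS]
    simp
  · intro t ht
    rw [Finset.mem_Iic] at ht
    funext c
    simp only [colorCount, Finset.filter_filter]
    conv_rhs => rw [← card_chainRank_lt hQ.mono c (t c) ((ht c).trans (hs c))]
    congr 1
    ext i
    simp only [Finset.mem_filter, Finset.mem_univ, true_and]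
    refine and_congr_left ?_
    rintro rfl
    rfl
  · intro S _
    rfl

theorem exists_avoiding_content [Fintype κ] (col : Fin N → κ) (w : List (Fin N)) :
    ∃ s ≤ chainCard col, (∀ i ∈ w, s (col i) ≤ chainRank col i) ∧
      ∀ c, s c < chainCard col c → (c, s c) ∈ w.map fun i => (col i, chainRank col i) := by
  -- The full length is adjoined so that the infimum equals it for a chain that `w` does not touch.
  let T : κ → Set ℕ := fun c =>
    insert (chainCard col c) {t | ∃ i ∈ w, col i = c ∧ chainRank col i = t}
  refine ⟨fun c => sInf (T c), fun c => Nat.sInf_le (Set.mem_insert _ _), fun i hi => ?_,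
    fun c h => ?_⟩
  · exact Nat.sInf_le (Set.mem_insert_of_mem _ ⟨i, hi, rfl, rfl⟩)
  · rcases Nat.sInf_mem (s := T c) ⟨_, Set.mem_insert _ _⟩ with h1 | ⟨i, hi, h1, h2⟩
    · exact absurd h1 h.ne
    · exact List.mem_map.2 ⟨i, hi, by rw [h1, h2]⟩

/-- The operator that moves the label `i` to the end. -/
noncomputable def promoteLabel (Q : PartialOrder (Fin N)) (i : Fin N) (π : LinearExtension Q) :
    LinearExtension Q :=
  promotion Q (π.1⁻¹ i) π

theorem IsChainUnion.wordOf_foldr_promoteLabel (hQ : IsChainUnion Q col) (w : List (Fin N))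
    (π : LinearExtension Q) : wordOf col (w.foldr (promoteLabel Q) π).1 =
      (w.map fun i => (col i, chainRank col i)).foldr moveToEnd (wordOf col π.1) := by
  induction w with
  | nil => rfl
  | cons i w ih =>
    rw [List.foldr_cons, List.map_cons, List.foldr_cons, ← ih, promoteLabel, hQ.wordOf_promotion,
      Equiv.Perm.inv_def, Equiv.apply_symm_apply]

theorem IsChainUnion.card_fixed_promoteLabel [Fintype κ] (hQ : IsChainUnion Q col)
    (w : List (Fin N)) :
    (Finset.univ.filter fun π : LinearExtension Q => w.foldr (promoteLabel Q) π = π).card =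
      ∑ S ∈ lowerSets Q with ∀ i ∈ w, i ∉ S, numDerangements (PosetPromotion.restrict Q S) := by
  obtain ⟨s, hs, hw, hc⟩ := exists_avoiding_content col w
  simp only [hQ.numDerangements_restrict]
  rw [hQ.sum_lowerSets w s hs hw hc fun t => numWordsFixing t 0, ← card_word_eq_sum,
    ← card_fixed_moveToEnd (chainCard col) s hs (w.map fun i => (col i, chainRank col i)) ?_ hc,
    ← Fintype.card_subtype, ← Nat.card_eq_fintype_card]
  · refine Nat.card_congr (Equiv.subtypeEquiv hQ.wordEquiv fun π => ?_)
    change _ ↔ List.foldr moveToEnd (wordOf col π.1) _ = wordOf col π.1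
    rw [← hQ.wordOf_foldr_promoteLabel, ← hQ.toWord_injective.eq_iff, Subtype.ext_iff]
    rfl
  · intro p hp
    obtain ⟨i, hi, rfl⟩ := List.mem_map.1 hp
    exact ⟨hw i hi, chainRank_lt_chainCard col i⟩

end LowerSets

/-! ### The transition matrix, its determinant, and the sum of chains. -/

section Matrix

variable {N : ℕ} {R : Type*} [CommRing R]

/-- Reindexing edges by the label `π j` makes the weight independent of `π`. Restoring the loops
then adds the same total weight to every diagonal entry as is subtracted by the scalar matrix. -/
theorem promotionMatrix_eq (P : PartialOrder (Fin N)) (x : Fin N → R) :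
    promotionMatrix P x = weightedMapMatrix (promoteLabel P) x - Matrix.scalar _ (∑ i, x i) := by
  classical
  have hsum : ∀ (π : LinearExtension P) (p : LinearExtension P → Prop) [DecidablePred p],
      ∑ j with p (promotion P j π), x (π.1 j) = ∑ i with p (promoteLabel P i π), x i := by
    intro π p _
    rw [Finset.sum_filter, Finset.sum_filter, 
      ← Equiv.sum_comp π.1 fun i => if p (promoteLabel P i π) then x i else 0]
    simp [promoteLabel]
  ext π' π
  rw [promotionMatrix, Matrix.of_apply, Matrix.sub_apply, weightedMapMatrix, Matrix.of_apply,
    Matrix.scalar_apply, Matrix.diagonal_apply]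
  split_ifs with h
  · subst h
    have h1 := hsum π' (· ≠ π')
    rw [eq_sub_iff_add_eq, neg_add_eq_iff_eq_add, ← Finset.sum_filter_add_sum_filter_not Finset.univ
      (fun i => promoteLabel P i π' = π') x, add_comm]
    congr 1
    convert h1.symm using 2
  · rw [sub_zero]
    convert hsum π (· = π') using 2

theorem det_sub_X_smul_one {n : Type*} [Fintype n] [DecidableEq n] (A : Matrix n n R) (a : R) :
    ((A - Matrix.scalar n a).map (C : R →+* R[X]) - (X : R[X]) • (1 : Matrix n n R[X])).det =
      (-1) ^ Fintype.card n * A.charpoly.comp (X + C a) := by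
  have h : (A - Matrix.scalar n a).map (C : R →+* R[X]) - (X : R[X]) • (1 : Matrix n n R[X]) =
      -(compRingHom (X + C a)).mapMatrix A.charmatrix := by
    ext1 i j
    by_cases hij : i = j
    · subst hij
      simp
      ring
    · simp [hij]
  rw [h, Matrix.det_neg, ← RingHom.map_det]
  rfl

theorem mem_nonemptyLowerSets (P : PartialOrder (Fin N)) (S : Finset (Fin N)) :
    S ∈ nonemptyLowerSets P ↔ S.Nonempty ∧ S ∈ lowerSets P := by
  simp [nonemptyLowerSets, lowerSets]

theorem lowerSets_eq (P : PartialOrder (Fin N)) :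
    lowerSets P = insert ∅ (nonemptyLowerSets P) := by
  ext S
  rw [Finset.mem_insert, mem_nonemptyLowerSets]
  rcases S.eq_empty_or_nonempty with rfl | h
  · simp [mem_lowerSets]
  · simp [h, h.ne_empty]

/-- The empty lower set accounts for the simple factor `X`, that is, for the eigenvalue `0`. -/
theorem numDerangements_restrict_empty (P : PartialOrder (Fin N)) :
    numDerangements (restrict P ∅) = 1 := by
  rw [numDerangements, Nat.card_eq_one_iff_unique]
  have : IsEmpty (Fin (∅ : Finset (Fin N)).card) := by
    rw [Finset.card_empty]
    infer_instance
  exact ⟨⟨fun _ _ => Subtype.ext (Subtype.ext (Subsingleton.elim _ _))⟩,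
    ⟨⟨⟨1, fun i => isEmptyElim i⟩, fun i => isEmptyElim i⟩⟩⟩

theorem det_promotionMatrix {κ : Type*} [LinearOrder κ] [Fintype κ] {P : PartialOrder (Fin N)}
    {col : Fin N → κ} (hP : IsChainUnion P col) (x : Fin N → R) :
    ((promotionMatrix P x).map (C : R →+* R[X]) -
        (X : R[X]) • (1 : Matrix (LinearExtension P) (LinearExtension P) R[X])).det =
      (-1 : R[X]) ^ Fintype.card (LinearExtension P) *
        (X * ∏ S ∈ nonemptyLowerSets P,
          (X + C (∑ i ∈ S, x i)) ^ numDerangements (restrict P S)) := by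
  rw [promotionMatrix_eq, det_sub_X_smul_one,
    charpoly_weightedMapMatrix (promoteLabel P) (lowerSets P)
      (fun S => numDerangements (restrict P S)) fun w => by
        convert hP.card_fixed_promoteLabel w]
  congr 1
  -- The shift by the total weight turns the eigenvalue `∑ i ∈ Sᶜ, x i` into `-∑ i ∈ S, x i`.
  have h : ∀ S : Finset (Fin N), (X - C (∑ i ∈ Sᶜ, x i)).comp (X + C (∑ i, x i)) =
      X + C (∑ i ∈ S, x i) := by
    intro S
    rw [← Finset.sum_add_sum_compl S x, sub_comp, X_comp, C_comp, C_add]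
    ring
  rw [prod_comp]
  simp only [pow_comp, h]
  rw [lowerSets_eq, Finset.prod_insert fun h' => by simpa using (mem_nonemptyLowerSets P ∅).1 h',
    numDerangements_restrict_empty]
  simp

theorem isChainUnion_chains {k : ℕ} (m : Fin k → ℕ) :
    IsChainUnion (chains m) fun i => (finSigmaFinEquiv.symm i).1 := by
  have hlt : ∀ a b : Σ i, Fin (m i), a.1 < b.1 → finSigmaFinEquiv a < finSigmaFinEquiv b := by
    intro a b h
    -- Extending `m` by zero to `ℕ` makes the partial sums for different `c` comparable.
    have key : ∀ c : Fin k, ∑ i : Fin (c : ℕ), m (Fin.castLE c.2.le i) =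
        ∑ i ∈ Finset.range c, if h : i < k then m ⟨i, h⟩ else 0 := by
      intro c
      rw [Finset.sum_range]
      refine Finset.sum_congr rfl fun i _ => ?_
      rw [dif_pos (i.2.trans c.2)]
      rfl
    rw [Fin.lt_def, finSigmaFinEquiv_apply, finSigmaFinEquiv_apply, key, key]
    have h1 : ∑ i ∈ Finset.range (a.1 + 1), (if h : i < k then m ⟨i, h⟩ else 0) ≤
        ∑ i ∈ Finset.range b.1, if h : i < k then m ⟨i, h⟩ else 0 :=
      Finset.sum_le_sum_of_subset (Finset.range_mono h)
    rw [Finset.sum_range_succ, dif_pos a.1.2] at h1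
    have h2 : (a.2 : ℕ) < m ⟨a.1, a.1.2⟩ := a.2.2
    omega
  have hle : ∀ (i : Fin k) (a b : Fin (m i)),
      finSigmaFinEquiv (⟨i, a⟩ : Σ i, Fin (m i)) ≤ finSigmaFinEquiv (⟨i, b⟩ : Σ i, Fin (m i)) ↔
        a ≤ b := by
    intro i a b
    rw [Fin.le_def, finSigmaFinEquiv_apply, finSigmaFinEquiv_apply, Nat.add_le_add_iff_left,
      Fin.le_def]
  constructor
  · intro i j hij
    by_contra h
    have := hlt _ _ (not_le.1 h)
    simp only [Equiv.apply_symm_apply] at this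
    exact absurd hij (Fin.not_le.2 this)
  · intro i j
    change finSigmaFinEquiv.symm i ≤ finSigmaFinEquiv.symm j ↔ _
    obtain ⟨a, rfl⟩ := finSigmaFinEquiv.surjective i
    obtain ⟨b, rfl⟩ := finSigmaFinEquiv.surjective j
    simp only [Equiv.symm_apply_apply]
    constructor
    · rintro ⟨i, a, b, h⟩
      exact ⟨rfl, (hle i a b).2 h⟩
    · obtain ⟨i, a⟩ := a
      obtain ⟨j, b⟩ := b
      rintro ⟨h1, h2⟩
      obtain rfl : i = j := h1
      exact Sigma.LE.fiber _ _ _ ((hle i a b).1 h2)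

end Matrix

end PosetPromotion

theorem mainTheorem2 {R : Type*} [CommRing R] (k : ℕ) (m : Fin k → ℕ)
    (x : Fin (∑ i, m i) → R) :
    ((PosetPromotion.promotionMatrix (PosetPromotion.chains m) x).map (C : R →+* R[X]) -
        (X : R[X]) • (1 : Matrix (PosetPromotion.LinearExtension (PosetPromotion.chains m))
          (PosetPromotion.LinearExtension (PosetPromotion.chains m)) R[X])).det =
      (-1 : R[X]) ^ Fintype.card (PosetPromotion.LinearExtension (PosetPromotion.chains m)) *
        (X * ∏ S ∈ PosetPromotion.nonemptyLowerSets (PosetPromotion.chains m),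
          (X + C (∑ i ∈ S, x i)) ^
            PosetPromotion.numDerangements
              (PosetPromotion.restrict (PosetPromotion.chains m) S)) :=
  PosetPromotion.det_promotionMatrix (PosetPromotion.isChainUnion_chains m) x
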